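/- Let $L$ be a non-negative self-adjoint operator (possibly unbounded) in a complex Hilbert space $\mathbf H$, and let $\sqrt L$ be its non-negative square root. For $\omega>0$ let $\mathbf{PW}_\omega(\sqrt L)$ be the set of vectors $f\in\mathbf H$ whose spectral transform with respect to $\sqrt L$ is supported in $[0,\omega]$, and let $\mathcal E(f,\omega)=\inf\{\|f-g\| : g\in \mathbf{PW}_\omega(\sqrt L)\}$. Let $\alpha>0$, $1\le q\le\infty$, and let $r\in\mathbb N$ with $r>\alpha$. Let $\mathbf H^r$ be the domain of $L^{r/2}=(\sqrt L)^r$ with the norm $\|f\|_{\mathbf H^r}=\|f\|+\|L^{r/2}f\|$, and let $\mathcal B^\alpha_{\mathbf H,q}(\sqrt L)=(\mathbf H,\mathbf H^r)^K_{\alpha/r,q}$ be the space of all $f\in\mathbf H$ for which $$\|f\|_{\mathcal B}=\Big(\int_0^\infty \big(t^{-\alpha/r}K(f,t)\big)^q\,\frac{dt}{t}\Big)^{1/q}<\infty,\qquad K(f,t)=\inf_{g\in\mathbf H^r}\big(\|f-g\|+t\|g\|_{\mathbf H^r}\big)$$ (for $q=\infty$: $\sup_{t>0}t^{-\alpha/r}K(f,t)<\infty$).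 Then $f\in\mathcal B^\alpha_{\mathbf H,q}(\sqrt L)$ if and only if $$\|f\|+\Big(\sum_{j=0}^\infty\big(2^{j\alpha}\mathcal E(f,2^j)\big)^q\Big)^{1/q}<\infty$$ (for $q=\infty$ the sum is replaced by $\sup_{j\ge0}2^{j\alpha}\mathcal E(f,2^j)$), and this expression is equivalent to the norm $\|f\|_{\mathcal B}$: there are constants $c,C>0$, independent of $f$, such that it lies between $c\|f\|_{\mathcal B}$ and $C\|f\|_{\mathcal B}$. The same holds if $\mathbf H^r$ is the Sobolev space of operators $D_1,\dots,D_d$ in $\mathbf H$, that is, the set of $f$ for which all $D_{i_1}\cdots D_{i_r}f$ $(1\le i_1,\dots,i_r\le d)$ are defined, with the norm $\|f\|+\sum_{i_1,\dots,i_r}\|D_{i_1}\cdots D_{i_r}f\|$, provided that this set is the domain of $L^{r/2}$ and that this norm is equivalent to $\|f\|+\|L^{r/2}f\|$ on it. -/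

import Mathlib

open scoped ENNReal NNReal

noncomputable section

namespace PaleyWiener

/-! ### Unbounded operators -/

section Operators

variable {H : Type*} [NormedAddCommGroup H] [InnerProductSpace ℂ H]

/-- The product `A B` of two unbounded operators, on its natural domain
`{f ∈ D(B) | B f ∈ D(A)}`. -/
def pmul (A B : H →ₗ.[ℂ] H) : H →ₗ.[ℂ] H :=
  A.comp (B.domRestrict ((A.domain.comap B.toFun).map B.domain.subtype)) (by
    rintro ⟨x, ⟨y, hy, hyx⟩, hx⟩
    have hval : B.domRestrict ((A.domain.comap B.toFun).map B.domain.subtype)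
        ⟨x, ⟨y, hy, hyx⟩, hx⟩ = B y := LinearPMap.domRestrict_apply hyx.symm
    rw [hval]
    exact hy)

theorem mem_pmul_domain {A B : H →ₗ.[ℂ] H} {f : H} :
    f ∈ (pmul A B).domain ↔ ∃ hf : f ∈ B.domain, B ⟨f, hf⟩ ∈ A.domain := by
  constructor
  · rintro ⟨⟨y, hy, rfl⟩, hx⟩
    exact ⟨hx, hy⟩
  · rintro ⟨hf, h⟩
    exact ⟨⟨⟨f, hf⟩, h, rfl⟩, hf⟩

theorem pmul_apply {A B : H →ₗ.[ℂ] H} (f : (pmul A B).domain) (hf : (f : H) ∈ B.domain)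
    (h : B ⟨f, hf⟩ ∈ A.domain) : pmul A B f = A ⟨B ⟨f, hf⟩, h⟩ := rfl

/-- The identity operator, defined everywhere. -/
def pone : H →ₗ.[ℂ] H := ⟨⊤, (⊤ : Submodule ℂ H).subtype⟩

/-- The powers `A ^ n` of an unbounded operator, on their natural domains. -/
def ppow (A : H →ₗ.[ℂ] H) : ℕ → (H →ₗ.[ℂ] H)
  | 0 => pone
  | n + 1 => pmul A (ppow A n)

/-- The product `D_{j₁} D_{j₂} ⋯ D_{jₖ}`, on its natural domain, for the list `j₁, j₂, …, jₖ`. -/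
def word {d : ℕ} (D : Fin d → (H →ₗ.[ℂ] H)) (l : List (Fin d)) : H →ₗ.[ℂ] H :=
  l.foldr (fun j A => pmul (D j) A) pone

/-- `⟨A f, f⟩ ≥ 0` for all `f ∈ D(A)`. -/
def IsNonneg (A : H →ₗ.[ℂ] H) : Prop :=
  ∀ f : A.domain, 0 ≤ RCLike.re (inner ℂ (A f) (f : H))

variable [CompleteSpace H]

/-- `S` is the positive square root of `L`: a non-negative self-adjoint operator with `S S = L`
(equality of domains included). -/
structure IsPosSqrt (S L : H →ₗ.[ℂ] H) : Prop where
  selfAdjoint : IsSelfAdjoint S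
  nonneg : IsNonneg S
  mul_self : pmul S S = L

open Classical in
/-- The positive square root `√L` of a non-negative self-adjoint operator `L`
(a junk value for other operators). -/
def posSqrt (L : H →ₗ.[ℂ] H) : H →ₗ.[ℂ] H :=
  if h : ∃ S, IsPosSqrt S L then h.choose else L

open Classical in
/-- The bounded operator `(1 + S)⁻¹`, for an operator `S` such that `1 + S` maps `D(S)`
bijectively onto `H` with bounded inverse, for instance a non-negative self-adjoint `S`
(a junk value for other operators). -/
def invOneAdd (S : H →ₗ.[ℂ] H) : H →L[ℂ] H :=
  if h : ∃ R : H →L[ℂ] H, ∀ g f : H,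
      R g = f ↔ ∃ hf : f ∈ S.domain, f + S ⟨f, hf⟩ = g then h.choose else 0

/-- The operator `F(S)` for a non-negative self-adjoint operator `S` and a continuous compactly
supported function `F`. With the bounded self-adjoint operator `R = (1 + S)⁻¹`, whose spectrum
lies in `[0, 1]`, one has `S = (1 - R) / R`, so that `F(S) = G(R)` for
`G(x) = F((1 - x) / x)`, `0 < x ≤ 1`, continued by `G(0) = 0`, which is the limit at `0` since
`F` vanishes near infinity. On the right is the continuous functional calculus of `R`. -/
def funCalc (S : H →ₗ.[ℂ] H) (F : ℝ → ℝ) : H →L[ℂ] H :=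
  cfc (fun x : ℝ => if 0 < x then F ((1 - x) / x) else 0) (invOneAdd S)

/-- The Paley-Wiener space `PW_ω(S)` of a non-negative self-adjoint operator `S`: the vectors `f`
whose spectral transform is supported in `[0, ω]`, that is, vanishes on `(ω, ∞)`. This is tested
with functions: `F(S) f = 0` for all continuous compactly supported `F` that vanish
outside `(ω, ∞)`. -/
def PW (S : H →ₗ.[ℂ] H) (ω : ℝ) : Submodule ℂ H where
  carrier := {f | ∀ F : ℝ → ℝ, Continuous F → HasCompactSupport F → (∀ l ≤ ω, F l = 0) →
    funCalc S F f = 0}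
  zero_mem' := fun F _ _ _ => map_zero _
  add_mem' := fun {f g} hf hg F h1 h2 h3 => by
    rw [map_add, hf F h1 h2 h3, hg F h1 h2 h3, add_zero]
  smul_mem' := fun c f hf F h1 h2 h3 => by
    rw [map_smul, hf F h1 h2 h3, smul_zero]

/-- The best approximation `𝓔(f, ω) = inf {‖f - g‖ : g ∈ PW_ω(S)}`. -/
def bestApprox (S : H →ₗ.[ℂ] H) (f : H) (ω : ℝ) : ℝ :=
  ⨅ g : PW S ω, ‖f - (g : H)‖

/-- The functional `‖f‖ + (∑_{j ≥ 0} (2^{jα} 𝓔(f, 2^j))^q)^{1/q}`, with a supremum in place of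
the sum when `q = ∞`. Its value is `∞` if the sum diverges. -/
def approxNorm (S : H →ₗ.[ℂ] H) (α : ℝ) (q : ℝ≥0∞) (f : H) : ℝ≥0∞ :=
  ENNReal.ofReal ‖f‖ +
    if q = ⊤ then
      ⨆ j : ℕ, ENNReal.ofReal ((2 : ℝ) ^ ((j : ℝ) * α) * bestApprox S f ((2 : ℝ) ^ j))
    else
      (∑' j : ℕ, ENNReal.ofReal
        ((2 : ℝ) ^ ((j : ℝ) * α) * bestApprox S f ((2 : ℝ) ^ j)) ^ q.toReal) ^ (1 / q.toReal)

end Operators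

/-! ### Real interpolation between `H` and a subspace with a norm of its own -/

section Interpolation

variable {H : Type*} [NormedAddCommGroup H] [InnerProductSpace ℂ H]

/-- Peetre's functional `K(f, t) = inf (‖f₀‖ + t N(f₁))` over all decompositions `f = f₀ + f₁`
with `f₀ ∈ H` and `f₁` in the subspace `V`, whose norm is `N`. -/
def KFunctional (V : Submodule ℂ H) (N : V → ℝ) (f : H) (t : ℝ) : ℝ :=
  ⨅ g : V, (‖f - (g : H)‖ + t * N g)

/-- The norm `(∫_0^∞ (t^{-θ} K(f, t))^q dt/t)^{1/q}` of `(H, V)^K_{θ,q}`, with a supremum over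
`t > 0` when `q = ∞`. As `V ⊆ H`, the sum `H + V` is `H`,
and `(H, V)^K_{θ,q}` is the set of all `f ∈ H` for which the value is finite. -/
def interpNorm (V : Submodule ℂ H) (N : V → ℝ) (θ : ℝ) (q : ℝ≥0∞) (f : H) : ℝ≥0∞ :=
  if q = ⊤ then
    ⨆ t : Set.Ioi (0 : ℝ), ENNReal.ofReal ((t : ℝ) ^ (-θ) * KFunctional V N f t)
  else
    (∫⁻ t in Set.Ioi (0 : ℝ),
      ENNReal.ofReal (t ^ (-θ) * KFunctional V N f t) ^ q.toReal * ENNReal.ofReal t⁻¹)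
        ^ (1 / q.toReal)

/-- The graph norm `‖f‖ + ‖A f‖` on the domain of `A`. -/
def graphNorm (A : H →ₗ.[ℂ] H) (f : A.domain) : ℝ := ‖(f : H)‖ + ‖A f‖

/-- The vectors on which all products `D_{i₁} ⋯ D_{iᵣ}` are defined. As the domains are the
natural ones, all shorter products are then defined as well. -/
def sobolevDomain {d : ℕ} (D : Fin d → (H →ₗ.[ℂ] H)) (r : ℕ) : Submodule ℂ H :=
  ⨅ w : Fin r → Fin d, (word D (List.ofFn w)).domain

/-- The Sobolev norm `‖f‖ + ∑ ‖D_{i₁} ⋯ D_{iᵣ} f‖`, the sum over `1 ≤ i₁, …, iᵣ ≤ d`. -/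
def sobolevNorm {d : ℕ} (D : Fin d → (H →ₗ.[ℂ] H)) (r : ℕ) (f : sobolevDomain D r) : ℝ :=
  ‖(f : H)‖ + ∑ w : Fin r → Fin d,
    ‖word D (List.ofFn w) ⟨(f : H), (Submodule.mem_iInf _).1 f.2 w⟩‖

/-- The operator `L^{r/2} = (√L)^r`. -/
def halfPow [CompleteSpace H] (L : H →ₗ.[ℂ] H) (r : ℕ) : H →ₗ.[ℂ] H := ppow (posSqrt L) r

/-- Two extended-valued functionals are finite on the same vectors, and there each is bounded by
a constant multiple of the other. -/
def EquivalentNorms (M N : H → ℝ≥0∞) : Prop :=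
  {f | M f < ⊤} = {f | N f < ⊤} ∧
    ∃ c C : ℝ≥0, 0 < c ∧ 0 < C ∧ ∀ f : H, c * M f ≤ N f ∧ N f ≤ C * M f

end Interpolation

end PaleyWiener

end

/-!
Write `S = √L` and `R = (1 + S)⁻¹`. The operator `R` is bounded and self-adjoint with spectrum in
`[0, 1]`, and `S ^ n` has the range of `R ^ n` as its domain, where it acts as
`R ^ n h ↦ (1 - R) ^ n h`. Everything about `S` therefore reduces to the continuous functional
calculus of `R`, and no spectral measure is needed. The square root itself is obtained from
`A = (1 + L)⁻¹`: the function `g(x) = √x / (√x + √(1 - x))` maps `1 / (1 + l ^ 2)` to `1 / (1 + l)`,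
so that the resolvent of `√L` is `g(A)` (`exists_isPosSqrt`).

Let `lowPass S ω` be `φ(S)` for a cut-off `φ` that is `1` on `[0, ω]` and `0` beyond `2ω`. It maps
into `PW_{2ω}` and is the identity on `PW_ω` (`lowPass_eq_self`). Hence `‖f - lowPass S ω f‖` lies
between `𝓔(f, 2ω)` and `𝓔(f, ω)`, and these operators can replace the best approximations. They
satisfy
* a Jackson inequality `‖g - lowPass S ω g‖ ≤ ω ^ (-r) ‖S ^ r g‖` (`norm_sub_lowPass_le_ppow`),
* a Bernstein inequality, up to the constant `2 ^ r`, `‖S ^ r g‖ ≤ (2ω) ^ r ‖g‖` for `g ∈ PW_ω`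
  (`norm_ppow_le_of_mem_PW`).

The first gives `𝓔(f, 2 ^ j) ≤ C K(f, 2 ^ (-jr))` (`bestApprox_le_mul_KFunctional`). The second,
applied to the pieces of the dyadic decomposition of `f`, gives
`K(f, 2 ^ (-jr)) ≤ C 2 ^ (-jr) ∑_{i ≤ j} 2 ^ (ir) a_i` for the sequence
`a = (‖f‖, 𝓔(f, 1), 𝓔(f, 2), 𝓔(f, 4), …)` (`KFunctional_le_sum`). As `K(f, t)` is
non-decreasing and `K(f, t) / t` is non-increasing in `t`, the interpolation norm is
equivalent to the `ℓ^q` norm of `2 ^ (jα) K(f, 2 ^ (-jr))`, and since `α < r` the discrete Hardy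
inequality `seqNorm_conv_le` turns these estimates into the equivalence of norms. They use only that
the norm of `H^r` is equivalent to the graph norm of `S ^ r`, which covers both choices of `H^r`.
-/

noncomputable section

namespace PaleyWiener

/-! ### The resolvent `(1 + S)⁻¹` -/

section Resolvent

variable {H : Type*} [NormedAddCommGroup H] [InnerProductSpace ℂ H]

/-- The bounded operator `R` is the everywhere defined inverse of `1 + S`. -/
def IsResolvent (S : H →ₗ.[ℂ] H) (R : H →L[ℂ] H) : Prop :=
  ∀ g f : H, R g = f ↔ ∃ hf : f ∈ S.domain, f + S ⟨f, hf⟩ = g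

theorem IsNonneg.norm_le_norm_add {S : H →ₗ.[ℂ] H} (h0 : IsNonneg S) (f : S.domain) :
    ‖(f : H)‖ ≤ ‖(f : H) + S f‖ := by
  have h1 : ‖(f : H)‖ * ‖(f : H)‖ ≤ RCLike.re (inner ℂ ((f : H) + S f) (f : H)) := by
    rw [inner_add_left, map_add, inner_self_eq_norm_mul_norm]
    linarith [h0 f]
  have h2 : RCLike.re (inner ℂ ((f : H) + S f) (f : H)) ≤ ‖(f : H) + S f‖ * ‖(f : H)‖ :=
    re_inner_le_norm _ _
  rcases (norm_nonneg (f : H)).eq_or_lt with h | h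
  · rw [← h]; exact norm_nonneg _
  · exact le_of_mul_le_mul_right (h1.trans h2) h

namespace IsResolvent

variable {S : H →ₗ.[ℂ] H} {R : H →L[ℂ] H}

theorem mem_domain (h : IsResolvent S R) (g : H) : R g ∈ S.domain := ((h g _).1 rfl).1

theorem apply_add (h : IsResolvent S R) (f : S.domain) : R ((f : H) + S f) = f :=
  (h _ _).2 ⟨f.2, rfl⟩

theorem apply (h : IsResolvent S R) (g : H) (hg : R g ∈ S.domain) : S ⟨R g, hg⟩ = g - R g := by
  obtain ⟨_, h2⟩ := (h g _).1 rfl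
  exact eq_sub_of_add_eq' h2

theorem mem_domain_iff (h : IsResolvent S R) {f : H} : f ∈ S.domain ↔ ∃ g, R g = f :=
  ⟨fun hf => ⟨_, h.apply_add ⟨f, hf⟩⟩, fun ⟨g, hg⟩ => hg ▸ h.mem_domain g⟩

theorem injective (h : IsResolvent S R) : Function.Injective R := by
  rw [injective_iff_map_eq_zero]
  intro g hg
  obtain ⟨h1, h2⟩ := (h g 0).1 hg
  have h3 : S ⟨0, h1⟩ = 0 := S.map_zero
  rw [← h2, h3, add_zero]

theorem norm_le_one (h : IsResolvent S R) (h0 : IsNonneg S) : ‖R‖ ≤ 1 := by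
  refine R.opNorm_le_bound zero_le_one fun g => ?_
  have h1 := h0.norm_le_norm_add ⟨R g, h.mem_domain g⟩
  rw [h.apply] at h1
  simpa using h1

end IsResolvent

variable [CompleteSpace H] {S : H →ₗ.[ℂ] H} {R : H →L[ℂ] H}

theorem _root_.IsSelfAdjoint.inner_linearPMap (hS : IsSelfAdjoint S) (f g : S.domain) :
    inner ℂ (S f) (g : H) = inner ℂ (f : H) (S g) := by
  have h := LinearPMap.adjoint_isFormalAdjoint hS.dense_domain (T := S)
  rw [LinearPMap.isSelfAdjoint_def.1 hS] at h
  exact h f g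

theorem IsResolvent.isSelfAdjoint (h : IsResolvent S R) (hS : IsSelfAdjoint S) :
    IsSelfAdjoint R := by
  rw [ContinuousLinearMap.isSelfAdjoint_iff_isSymmetric]
  intro g g'
  have h1 := hS.inner_linearPMap ⟨R g, h.mem_domain g⟩ ⟨R g', h.mem_domain g'⟩
  rw [h.apply, h.apply, inner_sub_left, inner_sub_right] at h1
  simpa using (sub_left_injective h1).symm

theorem IsResolvent.nonneg (h : IsResolvent S R) (hS : IsSelfAdjoint S) (h0 : IsNonneg S) :
    0 ≤ R := by
  rw [ContinuousLinearMap.nonneg_iff_isPositive, ContinuousLinearMap.isPositive_def']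
  refine ⟨h.isSelfAdjoint hS, fun g => ?_⟩
  have h1 := h0 ⟨R g, h.mem_domain g⟩
  rw [h.apply, inner_sub_left, map_sub, inner_self_eq_norm_mul_norm] at h1
  rw [ContinuousLinearMap.reApplyInnerSelf_apply, inner_re_symm]
  nlinarith [norm_nonneg (R g)]

theorem spectrum_subset_Icc (h : 0 ≤ R) (h1 : ‖R‖ ≤ 1) : spectrum ℝ R ⊆ Set.Icc 0 1 := by
  intro x hx
  refine ⟨spectrum_nonneg_of_nonneg h hx, ?_⟩
  calc x ≤ ‖x‖ := Real.le_norm_self x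
    _ ≤ ‖R‖ * ‖(1 : H →L[ℂ] H)‖ := spectrum.norm_le_norm_mul_of_mem hx
    _ ≤ 1 := mul_le_one₀ h1 (norm_nonneg _) ContinuousLinearMap.norm_id_le

/-- `1 + S` is bounded below, so its range is closed because `S` is closed; a vector orthogonal to
the range lies in the domain of the adjoint `S` and satisfies `S y = -y`, so the range is dense. -/
theorem exists_isResolvent (hS : IsSelfAdjoint S) (h0 : IsNonneg S) :
    ∃ R : H →L[ℂ] H, IsResolvent S R := by
  set T : S.domain →ₗ[ℂ] H := S.domain.subtype + S.toFun with hT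
  have hTa : ∀ f, T f = f + S f := fun f => rfl
  have hinj : Function.Injective T := by
    rw [injective_iff_map_eq_zero]
    intro f hf
    have := h0.norm_le_norm_add f
    rw [← hTa, hf, norm_zero] at this
    exact Subtype.ext (norm_le_zero_iff.1 this)
  have hclosed : IsClosed (LinearMap.range T : Set H) := by
    have hG : IsClosed (S.graph : Set (H × H)) := hS.isClosed
    have : CompleteSpace S.graph := hG.completeSpace_coe
    let Φ : S.graph →L[ℂ] H :=
      (ContinuousLinearMap.fst ℂ H H + ContinuousLinearMap.snd ℂ H H).comp S.graph.subtypeL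
    have hΦ : AntilipschitzWith 2 Φ := by
      refine AddMonoidHomClass.antilipschitz_of_bound Φ fun p => ?_
      obtain ⟨⟨x, y⟩, hp⟩ := p
      obtain ⟨f, rfl, rfl⟩ := S.mem_graph_iff.1 hp
      have h1 := h0.norm_le_norm_add f
      have h2 : ‖S f‖ ≤ ‖(f : H) + S f‖ + ‖(f : H)‖ := by
        simpa using norm_sub_le ((f : H) + S f) f
      have h3 : Φ ⟨((f : H), S f), hp⟩ = (f : H) + S f := rfl
      rw [h3]
      change max ‖(f : H)‖ ‖S f‖ ≤ _
      push_cast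
      exact max_le (by linarith [norm_nonneg ((f : H) + S f)]) (by linarith)
    have h4 := hΦ.isClosed_range Φ.uniformContinuous
    convert h4 using 1
    ext y
    constructor
    · rintro ⟨f, rfl⟩
      exact ⟨⟨(f, S f), S.mem_graph f⟩, rfl⟩
    · rintro ⟨⟨⟨x, y⟩, hp⟩, rfl⟩
      obtain ⟨f, rfl, rfl⟩ := S.mem_graph_iff.1 hp
      exact ⟨f, rfl⟩
  have hsurj : Function.Surjective T := by
    rw [← LinearMap.range_eq_top]
    have : (LinearMap.range T).HasOrthogonalProjection := by
      have := hclosed.completeSpace_coe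
      infer_instance
    rw [← Submodule.orthogonal_eq_bot_iff, Submodule.eq_bot_iff]
    intro y hy
    have h1 : ∀ x : S.domain, inner ℂ (-y) (x : H) = inner ℂ y (S x) := by
      intro x
      have h2 := (Submodule.mem_orthogonal' _ _).1 hy _ ⟨x, rfl⟩
      rw [hTa, inner_add_right] at h2
      rw [inner_neg_left]
      linear_combination -h2
    have h2 := S.mem_adjoint_domain_of_exists y ⟨-y, h1⟩
    have h3 := LinearPMap.adjoint_apply_eq hS.dense_domain ⟨y, h2⟩ h1
    have key : ∃ hy : y ∈ S.domain, S ⟨y, hy⟩ = -y := by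
      generalize hB : LinearPMap.adjoint S = B at *
      rw [LinearPMap.isSelfAdjoint_def.1 hS] at hB
      subst hB
      exact ⟨h2, h3⟩
    obtain ⟨hy1, hy2⟩ := key
    have h4 := h0.norm_le_norm_add ⟨y, hy1⟩
    rw [hy2] at h4
    simpa using h4
  let e := LinearEquiv.ofBijective T ⟨hinj, hsurj⟩
  refine ⟨(S.domain.subtype ∘ₗ e.symm.toLinearMap).mkContinuous 1 fun g => ?_, fun g f => ?_⟩
  · obtain ⟨f, rfl⟩ := e.surjective g
    have h1 : ‖(f : H)‖ ≤ ‖e f‖ := h0.norm_le_norm_add f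
    simpa using h1
  · obtain ⟨x, rfl⟩ := e.surjective g
    simp only [LinearMap.mkContinuous_apply, LinearMap.comp_apply, LinearEquiv.coe_coe,
      LinearEquiv.symm_apply_apply, Submodule.subtype_apply]
    constructor
    · rintro rfl
      exact ⟨x.2, rfl⟩
    · rintro ⟨hf, h⟩
      exact congrArg Subtype.val (hinj (a₁ := ⟨f, hf⟩) h).symm

theorem isResolvent_invOneAdd (hS : IsSelfAdjoint S) (h0 : IsNonneg S) :
    IsResolvent S (invOneAdd S) := by
  have h : ∃ R : H →L[ℂ] H, ∀ g f : H,
      R g = f ↔ ∃ hf : f ∈ S.domain, f + S ⟨f, hf⟩ = g := exists_isResolvent hS h0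
  unfold invOneAdd
  rw [dif_pos h]
  exact h.choose_spec

end Resolvent

/-! ### Existence of the positive square root -/

section SquareRoot

variable {H : Type*} [NormedAddCommGroup H] [InnerProductSpace ℂ H]

/-- The operator `T⁻¹ - 1`, with the range of `T` as its domain, for an injective bounded `T`. -/
def invSubOne (T : H →L[ℂ] H) (hT : Function.Injective T) : H →ₗ.[ℂ] H where
  domain := LinearMap.range (T : H →ₗ[ℂ] H)
  toFun := (LinearEquiv.ofInjective (T : H →ₗ[ℂ] H) hT).symm.toLinearMap
    - (LinearMap.range (T : H →ₗ[ℂ] H)).subtype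

theorem invSubOne_apply {T : H →L[ℂ] H} (hT : Function.Injective T) (g : H)
    (hg : T g ∈ (invSubOne T hT).domain) : invSubOne T hT ⟨T g, hg⟩ = g - T g := by
  change (LinearEquiv.ofInjective (T : H →ₗ[ℂ] H) hT).symm ⟨T g, hg⟩ - T g = g - T g
  congr 1
  rw [LinearEquiv.symm_apply_eq]
  rfl

theorem isResolvent_invSubOne {T : H →L[ℂ] H} (hT : Function.Injective T) :
    IsResolvent (invSubOne T hT) T := by
  intro g f
  constructor
  · rintro rfl
    exact ⟨⟨g, rfl⟩, (congrArg (T g + ·) (invSubOne_apply hT g ⟨g, rfl⟩)).trans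
      (add_sub_cancel _ _)⟩
  · rintro ⟨⟨x, rfl⟩, rfl⟩
    exact congrArg T ((congrArg (T x + ·) (invSubOne_apply hT x ⟨x, rfl⟩)).trans
      (add_sub_cancel _ _))

variable [CompleteSpace H]

theorem isSelfAdjoint_invSubOne {T : H →L[ℂ] H} (hT : Function.Injective T)
    (hsa : IsSelfAdjoint T) : IsSelfAdjoint (invSubOne T hT) := by
  have hsym : ∀ x y : H, inner ℂ (T x) y = inner ℂ x (T y) :=
    ContinuousLinearMap.isSelfAdjoint_iff_isSymmetric.1 hsa
  have hdense : Dense ((invSubOne T hT).domain : Set H) := by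
    change Dense ((LinearMap.range (T : H →ₗ[ℂ] H)) : Set H)
    rw [Submodule.dense_iff_topologicalClosure_eq_top,
      Submodule.topologicalClosure_eq_top_iff, Submodule.eq_bot_iff]
    intro y hy
    refine hT (ext_inner_left ℂ fun x => ?_)
    rw [map_zero, inner_zero_right, ← hsym]
    exact hy _ ⟨x, rfl⟩
  have hle : invSubOne T hT ≤ LinearPMap.adjoint (invSubOne T hT) := by
    refine LinearPMap.IsFormalAdjoint.le_adjoint hdense ?_
    rintro ⟨_, x, rfl⟩ ⟨_, y, rfl⟩
    have h1 := invSubOne_apply hT x ⟨x, rfl⟩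
    have h2 := invSubOne_apply hT y ⟨y, rfl⟩
    simp only [ContinuousLinearMap.coe_coe] at h1 h2 ⊢
    rw [h1, h2, inner_sub_left, inner_sub_right, hsym x y, hsym x (T y)]
  rw [LinearPMap.isSelfAdjoint_def]
  refine (LinearPMap.eq_of_le_of_domain_eq hle (le_antisymm hle.1 fun y hy => ?_)).symm
  set z := LinearPMap.adjoint (invSubOne T hT) ⟨y, hy⟩ with hz
  refine ⟨y + z, ext_inner_right ℂ fun x => ?_⟩
  have h1 := LinearPMap.adjoint_isFormalAdjoint hdense ⟨y, hy⟩ ⟨T x, ⟨x, rfl⟩⟩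
  have h2 := invSubOne_apply hT x ⟨x, rfl⟩
  simp only [ContinuousLinearMap.coe_coe] at h1 h2 ⊢
  rw [← hz, h2, inner_sub_right] at h1
  rw [hsym, inner_add_left, h1]
  abel

theorem isNonneg_invSubOne {T : H →L[ℂ] H} (hT : Function.Injective T)
    (h : 0 ≤ T - T * T) (hsa : IsSelfAdjoint T) : IsNonneg (invSubOne T hT) := by
  have hsym : ∀ x y : H, inner ℂ (T x) y = inner ℂ x (T y) :=
    ContinuousLinearMap.isSelfAdjoint_iff_isSymmetric.1 hsa
  rintro ⟨_, x, rfl⟩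
  have h1 := invSubOne_apply hT x ⟨x, rfl⟩
  simp only [ContinuousLinearMap.coe_coe] at h1 ⊢
  have h2 := (ContinuousLinearMap.isPositive_def'.1
    ((ContinuousLinearMap.nonneg_iff_isPositive _).1 h)).2 x
  rw [ContinuousLinearMap.reApplyInnerSelf_apply] at h2
  rw [h1, ← hsym]
  rw [map_sub]
  exact h2

theorem cfc_mul_cfc_eq {a : H →L[ℂ] H} {f g h : ℝ → ℝ} (hf : ContinuousOn f (spectrum ℝ a))
    (hg : ContinuousOn g (spectrum ℝ a)) (e : ∀ x ∈ spectrum ℝ a, f x * g x = h x) :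
    cfc f a * cfc g a = cfc h a :=
  (cfc_mul f g a hf hg).symm.trans (cfc_congr e)

theorem one_sub_cfc {a : H →L[ℂ] H} (ha : IsSelfAdjoint a) {f : ℝ → ℝ}
    (hf : ContinuousOn f (spectrum ℝ a)) : 1 - cfc f a = cfc (fun x => 1 - f x) a := by
  rw [cfc_sub _ _ a continuousOn_const hf, cfc_const_one ℝ a]

/-- With `A = (1 + L)⁻¹` and `s(x) = √x + √(1 - x)`, the operator `T = (√x / s)(A)` is the resolvent
of the square root. Indeed `A = T² W` and `1 - A = (1 - T)² W` for the invertible operator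
`W = (s²)(A)`, and therefore `(T⁻¹ - 1)² = A⁻¹ - 1`, domains included. -/
theorem exists_isPosSqrt {L : H →ₗ.[ℂ] H} (hL : IsSelfAdjoint L) (hL0 : IsNonneg L) :
    ∃ S, IsPosSqrt S L := by
  obtain ⟨A, hA⟩ := exists_isResolvent hL hL0
  have hsa := hA.isSelfAdjoint hL
  have hsp := spectrum_subset_Icc (hA.nonneg hL hL0) (hA.norm_le_one hL0)
  let s : ℝ → ℝ := fun x => √x + √(1 - x)
  have hs : ∀ x ∈ spectrum ℝ A, 0 < s x := by
    intro x hx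
    obtain ⟨h0, h1⟩ := hsp hx
    rcases h0.eq_or_lt with h | h
    · simp [s, ← h]
    · exact add_pos_of_pos_of_nonneg (Real.sqrt_pos.2 h) (Real.sqrt_nonneg _)
  have hsc : Continuous s := by fun_prop
  have hgc : ContinuousOn (fun x => √x / s x) (spectrum ℝ A) :=
    (Real.continuous_sqrt.continuousOn).div hsc.continuousOn fun x hx => (hs x hx).ne'
  have hwc : ContinuousOn (fun x => s x ^ 2) (spectrum ℝ A) := (hsc.pow 2).continuousOn
  have hvc : ContinuousOn (fun x => (s x ^ 2)⁻¹) (spectrum ℝ A) :=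
    hwc.inv₀ fun x hx => (pow_pos (hs x hx) 2).ne'
  set T := cfc (fun x => √x / s x) A with hTdef
  set W := cfc (fun x => s x ^ 2) A with hWdef
  set V := cfc (fun x => (s x ^ 2)⁻¹) A with hVdef
  have hidc : ContinuousOn (fun x : ℝ => x) (spectrum ℝ A) := continuousOn_id
  have hggc : ContinuousOn (fun x => (√x / s x) * (√x / s x)) (spectrum ℝ A) := hgc.mul hgc
  have hAid : cfc (fun x : ℝ => x) A = A := cfc_id' ℝ A
  have hTT2 : T * T = cfc (fun x => (√x / s x) * (√x / s x)) A :=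
    cfc_mul_cfc_eq hgc hgc fun x _ => rfl
  have hTT : T * T = A * V := by
    rw [hTT2, hVdef]
    nth_rewrite 2 [← hAid]
    refine (cfc_mul_cfc_eq hidc hvc fun x hx => ?_).symm
    have := hs x hx
    have h2 := Real.mul_self_sqrt (hsp hx).1
    field_simp
    rw [sq, h2]
  have hAW : A = T * T * W := by
    rw [hTT2, hWdef]
    nth_rewrite 1 [← hAid]
    refine (cfc_mul_cfc_eq hggc hwc fun x hx => ?_).symm
    have := hs x hx
    have h2 := Real.mul_self_sqrt (hsp hx).1
    field_simp
    rw [sq, h2]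
  have h1A : 1 - A = (1 - T) * (1 - T) * W := by
    have h1c : ContinuousOn (fun x => 1 - √x / s x) (spectrum ℝ A) := continuousOn_const.sub hgc
    have h1cc : ContinuousOn (fun x => (1 - √x / s x) * (1 - √x / s x)) (spectrum ℝ A) :=
      h1c.mul h1c
    rw [hTdef, one_sub_cfc hsa hgc, cfc_mul_cfc_eq h1c h1c fun x _ => rfl]
    nth_rewrite 1 [← hAid]
    rw [one_sub_cfc hsa hidc]
    refine (cfc_mul_cfc_eq h1cc hwc fun x hx => ?_).symm
    have h1 := hs x hx
    have h2 := Real.mul_self_sqrt (sub_nonneg.2 (hsp hx).2)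
    have h3 : 1 - √x / s x = √(1 - x) / s x := by
      field_simp
      simp [s]
    rw [h3]
    field_simp
    rw [sq, h2]
  have hWT : W * T = T * W := (cfc_mul_cfc_eq hwc hgc fun x _ => mul_comm _ _).trans
    (cfc_mul_cfc_eq hgc hwc fun x _ => rfl).symm
  have hTinj : Function.Injective T := by
    rw [injective_iff_map_eq_zero]
    intro f hf
    apply (injective_iff_map_eq_zero A).1 hA.injective
    have h1 : A = W * T * T := by rw [hWT, mul_assoc, hWT, ← mul_assoc, ← hAW]
    rw [h1]
    change W (T (T f)) = 0
    rw [hf, map_zero, map_zero]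
  have hTsa : IsSelfAdjoint T := cfc_predicate _ A
  have hTT0 : 0 ≤ T - T * T := by
    rw [hTT2, hTdef, ← cfc_sub _ _ A hgc hggc]
    refine cfc_nonneg fun x hx => ?_
    have h1 : 0 ≤ √x / s x := div_nonneg (Real.sqrt_nonneg _) (hs x hx).le
    have h2 : √x / s x ≤ 1 :=
      (div_le_one (hs x hx)).2 (le_add_of_nonneg_right (Real.sqrt_nonneg _))
    nlinarith
  refine ⟨invSubOne T hTinj, isSelfAdjoint_invSubOne hTinj hTsa,
    isNonneg_invSubOne hTinj hTT0 hTsa, ?_⟩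
  have hS := isResolvent_invSubOne hTinj
  set S := invSubOne T hTinj with hSdef
  have key : ∀ f (hf : f ∈ L.domain), ∃ hf' : f ∈ (pmul S S).domain,
      L ⟨f, hf⟩ = pmul S S ⟨f, hf'⟩ := by
    intro f hf
    obtain ⟨h, rfl⟩ := hA.mem_domain_iff.1 hf
    rw [hA.apply]
    have e1 : A h = T (T (W h)) := by rw [hAW]; rfl
    have e2 : h - A h = (W h - T (W h)) - T (W h - T (W h)) := by
      have := congrArg (fun B : H →L[ℂ] H => B h) h1A
      simpa [mul_sub, sub_mul] using this
    have m1 : A h ∈ S.domain := e1 ▸ hS.mem_domain _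
    have e3 : S ⟨A h, m1⟩ = T (W h - T (W h)) := by
      have : ∀ x (hx : x ∈ S.domain), x = T (T (W h)) → S ⟨x, hx⟩ = T (W h - T (W h)) := by
        rintro _ hx rfl
        rw [hS.apply, map_sub]
      exact this _ _ e1
    have m2 : S ⟨A h, m1⟩ ∈ S.domain := e3 ▸ hS.mem_domain _
    refine ⟨mem_pmul_domain.2 ⟨m1, m2⟩, ?_⟩
    rw [pmul_apply _ m1 m2, e2]
    have : ∀ x (hx : x ∈ S.domain), x = T (W h - T (W h)) →
        S ⟨x, hx⟩ = (W h - T (W h)) - T (W h - T (W h)) := by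
      rintro _ hx rfl
      rw [hS.apply]
    exact (this _ _ e3).symm
  have hle : L ≤ pmul S S := by
    refine ⟨fun f hf => (key f hf).1, ?_⟩
    rintro ⟨f, hf⟩ ⟨g, hg⟩ (rfl : f = g)
    exact (key f hf).2
  refine (LinearPMap.eq_of_le_of_domain_eq hle (le_antisymm hle.1 fun f hf => ?_)).symm
  obtain ⟨hf1, hf2⟩ := mem_pmul_domain.1 hf
  obtain ⟨g, rfl⟩ := hS.mem_domain_iff.1 hf1
  rw [hS.apply] at hf2
  obtain ⟨k, hk⟩ := hS.mem_domain_iff.1 hf2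
  have e1 : g = T (g + k) := by rw [map_add, hk]; abel
  have e2 : T g = A (V (g + k)) := by
    conv_lhs => rw [e1]
    exact congrArg (fun B : H →L[ℂ] H => B (g + k)) hTT
  rw [e2]
  exact hA.mem_domain _

theorem isPosSqrt_posSqrt {L : H →ₗ.[ℂ] H} (hL : IsSelfAdjoint L) (hL0 : IsNonneg L) :
    IsPosSqrt (posSqrt L) L := by
  have h := exists_isPosSqrt hL hL0
  unfold posSqrt
  rw [dif_pos h]
  exact h.choose_spec

end SquareRoot

/-! ### Powers of an unbounded operator in terms of its resolvent -/

section Powers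

variable {H : Type*} [NormedAddCommGroup H] [InnerProductSpace ℂ H]
  {S : H →ₗ.[ℂ] H} {R : H →L[ℂ] H}

theorem IsResolvent.apply_of_eq (h : IsResolvent S R) {x y : H} (hx : x ∈ S.domain)
    (e : x = R y) : S ⟨x, hx⟩ = y - R y := by
  subst e
  exact h.apply _ _

/-- `S ^ n` maps `R ^ n g` to `(1 - R) ^ n g`. -/
theorem IsResolvent.ppow_pow_apply (h : IsResolvent S R) (n : ℕ) (g : H) :
    ∃ hg : (R ^ n) g ∈ (ppow S n).domain, ppow S n ⟨(R ^ n) g, hg⟩ = ((1 - R) ^ n) g := by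
  induction n generalizing g with
  | zero => exact ⟨trivial, rfl⟩
  | succ n ih =>
    have e0 : (R ^ (n + 1)) g = (R ^ n) (R g) := by rw [pow_succ]; rfl
    rw [e0]
    obtain ⟨h1, h2⟩ := ih (R g)
    have hc : Commute ((1 - R) ^ n) R := ((Commute.one_left R).sub_left (Commute.refl R)).pow_left n
    have e1 : ((1 - R) ^ n) (R g) = R (((1 - R) ^ n) g) :=
      congrArg (fun B : H →L[ℂ] H => B g) hc.eq
    have h3 : ppow S n ⟨(R ^ n) (R g), h1⟩ ∈ S.domain := by
      rw [h2, e1]; exact h.mem_domain _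
    refine ⟨mem_pmul_domain.2 ⟨h1, h3⟩, ?_⟩
    refine (pmul_apply _ h1 h3).trans ?_
    rw [h.apply_of_eq h3 (h2.trans e1), pow_succ']
    rfl

theorem IsResolvent.mem_ppow_domain_iff (h : IsResolvent S R) (n : ℕ) {f : H} :
    f ∈ (ppow S n).domain ↔ ∃ g, (R ^ n) g = f := by
  refine ⟨fun hf => ?_, fun ⟨g, hg⟩ => hg ▸ (h.ppow_pow_apply n g).1⟩
  induction n with
  | zero => exact ⟨f, rfl⟩
  | succ n ih =>
    obtain ⟨h1, h2⟩ := mem_pmul_domain.1 hf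
    obtain ⟨g, rfl⟩ := ih h1
    obtain ⟨k, hk⟩ := h.mem_domain_iff.1 h2
    rw [(h.ppow_pow_apply n g).2] at hk
    -- `(1 - R) ^ n ≡ 1` modulo `R`, so that `g` lies in the range of `R` as `(1 - R) ^ n g` does
    obtain ⟨p, hp⟩ : ∃ p : H →L[ℂ] H, (1 - R) ^ n = 1 + R * p := by
      clear hk ih h1 h2 hf
      induction n with
      | zero => exact ⟨0, by simp⟩
      | succ n ih =>
        obtain ⟨p, hp⟩ := ih
        exact ⟨p - (1 - R) ^ n, by rw [pow_succ', sub_mul, one_mul, mul_sub, hp]; abel⟩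
    refine ⟨k - p g, ?_⟩
    have e : R (k - p g) = g := by
      rw [map_sub, hk, hp]
      change g + R (p g) - R (p g) = g
      abel
    rw [pow_succ]
    change (R ^ n) (R (k - p g)) = (R ^ n) g
    rw [e]

theorem ppow_congr {n : ℕ} {x y : H} (hx : x ∈ (ppow S n).domain) (e : x = y)
    (hy : y ∈ (ppow S n).domain) : ppow S n ⟨x, hx⟩ = ppow S n ⟨y, hy⟩ := by
  subst e; rfl

end Powers

/-! ### Functions of the operator -/

section FunctionalCalculus

variable {H : Type*} [NormedAddCommGroup H] [InnerProductSpace ℂ H] [CompleteSpace H]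
  {S : H →ₗ.[ℂ] H}

/-- The function of `(1 + S)⁻¹` which represents `F(S)`. -/
def symbol (F : ℝ → ℝ) (x : ℝ) : ℝ := if 0 < x then F ((1 - x) / x) else 0

theorem funCalc_eq (F : ℝ → ℝ) : funCalc S F = cfc (symbol F) (invOneAdd S) := rfl

theorem continuous_symbol {F : ℝ → ℝ} (hF : Continuous F) {M : ℝ} (hM : ∀ l, M ≤ l → F l = 0) :
    Continuous (symbol F) := by
  wlog h0 : 0 ≤ M generalizing M
  · exact this (M := 0) (fun l hl => hM l ((not_le.1 h0).le.trans hl)) le_rfl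
  have hM1 : 0 < 1 + M := by linarith
  -- for `x ≤ (1 + M)⁻¹` both sides vanish
  have : symbol F = fun x => F ((1 - x) / max x (1 + M)⁻¹) := by
    funext x
    rcases le_total (1 + M)⁻¹ x with h | h
    · rw [max_eq_left h, symbol, if_pos ((inv_pos.2 hM1).trans_le h)]
    · have h1 : x * (1 + M) ≤ 1 := by rwa [← le_div_iff₀ hM1, one_div]
      rw [max_eq_right h, hM _ (by rw [div_inv_eq_mul]; nlinarith), symbol]
      split_ifs with hx
      · exact hM _ (by rw [le_div_iff₀ hx]; linarith)
      · rfl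
  rw [this]
  refine hF.comp (Continuous.div (by fun_prop) (by fun_prop) fun x => ?_)
  exact ((inv_pos.2 hM1).trans_le (le_max_right _ _)).ne'

theorem symbol_norm_le {F : ℝ → ℝ} {c : ℝ} (hc : 0 ≤ c) (h : ∀ l, 0 ≤ l → |F l| ≤ c) {x : ℝ}
    (hx : x ∈ Set.Icc (0 : ℝ) 1) : |symbol F x| ≤ c := by
  unfold symbol
  split_ifs with h0
  · exact h _ (div_nonneg (sub_nonneg.2 hx.2) h0.le)
  · simpa

/-- The piecewise linear function that is `1` on `(-∞, ω]` and `0` on `[2ω, ∞)`. -/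
def cutoff (ω l : ℝ) : ℝ := max 0 (min 1 (2 - l / ω))

theorem continuous_cutoff (ω : ℝ) : Continuous (cutoff ω) := by
  unfold cutoff
  simp only [div_eq_mul_inv]
  fun_prop

theorem cutoff_nonneg (ω l : ℝ) : 0 ≤ cutoff ω l := le_max_left _ _

theorem cutoff_le_one (ω l : ℝ) : cutoff ω l ≤ 1 := max_le zero_le_one (min_le_left _ _)

theorem cutoff_eq_one {ω l : ℝ} (hω : 0 < ω) (h : l ≤ ω) : cutoff ω l = 1 := by
  have : l / ω ≤ 1 := (div_le_one hω).2 h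
  rw [cutoff, min_eq_left (by linarith), max_eq_right zero_le_one]

theorem cutoff_eq_zero {ω l : ℝ} (hω : 0 < ω) (h : 2 * ω ≤ l) : cutoff ω l = 0 := by
  have : 2 ≤ l / ω := (le_div_iff₀ hω).2 h
  rw [cutoff, min_eq_right (by linarith), max_eq_left (by linarith)]

/-- The operator `φ(S)` for the cut-off function `φ` at the frequency `ω`. It maps into
`PW_{2ω}(S)` and is the identity on `PW_ω(S)`. -/
def lowPass (S : H →ₗ.[ℂ] H) (ω : ℝ) : H →L[ℂ] H := funCalc S (cutoff ω)

/-- A continuous function that vanishes near `+∞`. -/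
def VanishesAtTop (F : ℝ → ℝ) : Prop := Continuous F ∧ ∃ M, ∀ l, M ≤ l → F l = 0

theorem VanishesAtTop.continuousOn_symbol {F : ℝ → ℝ} (hF : VanishesAtTop F) (s : Set ℝ) :
    ContinuousOn (symbol F) s :=
  hF.2.elim fun _ h => (continuous_symbol hF.1 h).continuousOn

theorem vanishesAtTop_cutoff {ω : ℝ} (hω : 0 < ω) : VanishesAtTop (cutoff ω) :=
  ⟨continuous_cutoff ω, 2 * ω, fun _ => cutoff_eq_zero hω⟩

theorem VanishesAtTop.mul_left {F G : ℝ → ℝ} (hF : VanishesAtTop F) (hG : Continuous G) :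
    VanishesAtTop (fun l => G l * F l) :=
  ⟨hG.mul hF.1, hF.2.imp fun M h l hl => by simp [h l hl]⟩

theorem funCalc_mul {F G : ℝ → ℝ} (hF : VanishesAtTop F) (hG : VanishesAtTop G) :
    funCalc S F * funCalc S G = funCalc S (fun l => F l * G l) := by
  refine cfc_mul_cfc_eq (hF.continuousOn_symbol _) (hG.continuousOn_symbol _) fun x _ => ?_
  split_ifs <;> simp

theorem funCalc_sub {F G : ℝ → ℝ} (hF : VanishesAtTop F) (hG : VanishesAtTop G) :
    funCalc S F - funCalc S G = funCalc S (fun l => F l - G l) := by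
  rw [funCalc_eq, funCalc_eq, ← cfc_sub _ _ _ (hF.continuousOn_symbol _) (hG.continuousOn_symbol _)]
  refine cfc_congr fun x _ => ?_
  simp only [symbol]
  split_ifs <;> simp

theorem funCalc_eq_zero {F : ℝ → ℝ} (hF : ∀ l, F l = 0) : funCalc S F = 0 := by
  rw [funCalc_eq, show symbol F = 0 by funext x; simp [symbol, hF]]
  exact cfc_zero ℝ _

theorem isSelfAdjoint_invOneAdd (hS : IsSelfAdjoint S) (h0 : IsNonneg S) :
    IsSelfAdjoint (invOneAdd S) :=
  (isResolvent_invOneAdd hS h0).isSelfAdjoint hS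

theorem spectrum_invOneAdd (hS : IsSelfAdjoint S) (h0 : IsNonneg S) :
    spectrum ℝ (invOneAdd S) ⊆ Set.Icc 0 1 :=
  spectrum_subset_Icc ((isResolvent_invOneAdd hS h0).nonneg hS h0)
    ((isResolvent_invOneAdd hS h0).norm_le_one h0)

theorem norm_funCalc_le (hS : IsSelfAdjoint S) (h0 : IsNonneg S) {F : ℝ → ℝ} {c : ℝ} (hc : 0 ≤ c)
    (h : ∀ l, 0 ≤ l → |F l| ≤ c) : ‖funCalc S F‖ ≤ c :=
  norm_cfc_le hc fun _ hx => symbol_norm_le hc h (spectrum_invOneAdd hS h0 hx)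

theorem pow_invOneAdd_eq (hS : IsSelfAdjoint S) (h0 : IsNonneg S) (n : ℕ) :
    invOneAdd S ^ n = cfc (fun x : ℝ => x ^ n) (invOneAdd S) :=
  (cfc_pow_id (R := ℝ) (invOneAdd S) n (isSelfAdjoint_invOneAdd hS h0)).symm

theorem one_sub_invOneAdd_pow_eq (hS : IsSelfAdjoint S) (h0 : IsNonneg S) (n : ℕ) :
    (1 - invOneAdd S) ^ n = cfc (fun x : ℝ => (1 - x) ^ n) (invOneAdd S) := by
  have hsa := isSelfAdjoint_invOneAdd hS h0
  rw [cfc_pow (fun x : ℝ => 1 - x) n (invOneAdd S) (by fun_prop) hsa,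
    ← one_sub_cfc hsa (f := fun x => x) (by fun_prop), cfc_id' ℝ (invOneAdd S) hsa]

/-- Each `F(S) f` is in the domain of `S ^ n`, and `S ^ n F(S) f` is given by `l ^ n F(l)`. -/
theorem ppow_funCalc_apply (hS : IsSelfAdjoint S) (h0 : IsNonneg S) {F : ℝ → ℝ}
    (hF : VanishesAtTop F) (n : ℕ) (f : H) :
    ∃ hf : funCalc S F f ∈ (ppow S n).domain,
      ppow S n ⟨funCalc S F f, hf⟩ = funCalc S (fun l => l ^ n * F l) f := by
  have hR := isResolvent_invOneAdd hS h0
  have hG : VanishesAtTop (fun l => (1 + l) ^ n * F l) := hF.mul_left (by fun_prop)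
  have e1 : funCalc S F = invOneAdd S ^ n * funCalc S (fun l => (1 + l) ^ n * F l) := by
    rw [pow_invOneAdd_eq hS h0]
    refine (cfc_mul_cfc_eq (by fun_prop) (hG.continuousOn_symbol _) fun x _ => ?_).symm
    simp only [symbol]
    split_ifs with hx
    · have : 1 + (1 - x) / x = x⁻¹ := by field_simp; ring
      rw [this, ← mul_assoc, ← mul_pow, mul_inv_cancel₀ hx.ne', one_pow, one_mul]
    · simp
  have e2 : (1 - invOneAdd S) ^ n * funCalc S (fun l => (1 + l) ^ n * F l)
      = funCalc S (fun l => l ^ n * F l) := by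
    rw [one_sub_invOneAdd_pow_eq hS h0]
    refine cfc_mul_cfc_eq (by fun_prop) (hG.continuousOn_symbol _) fun x _ => ?_
    split_ifs with hx
    · have : 1 + (1 - x) / x = x⁻¹ := by field_simp; ring
      simp only [this]
      rw [← mul_assoc, ← mul_pow, div_eq_mul_inv]
    · simp
  obtain ⟨h1, h2⟩ := hR.ppow_pow_apply n (funCalc S (fun l => (1 + l) ^ n * F l) f)
  have e3 : funCalc S F f = (invOneAdd S ^ n) (funCalc S (fun l => (1 + l) ^ n * F l) f) :=
    congrArg (fun B : H →L[ℂ] H => B f) e1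
  rw [← e2]
  have : ∀ x, x = (invOneAdd S ^ n) (funCalc S (fun l => (1 + l) ^ n * F l) f) →
      ∃ hf : x ∈ (ppow S n).domain, ppow S n ⟨x, hf⟩
        = ((1 - invOneAdd S) ^ n * funCalc S (fun l => (1 + l) ^ n * F l)) f := by
    rintro _ rfl
    exact ⟨h1, h2⟩
  exact this _ e3

end FunctionalCalculus

/-! ### Jackson and Bernstein inequalities -/

section JacksonBernstein

variable {H : Type*} [NormedAddCommGroup H] [InnerProductSpace ℂ H] [CompleteSpace H]
  {S : H →ₗ.[ℂ] H}

theorem lowPass_mem_PW {ω : ℝ} (hω : 0 < ω) (f : H) : lowPass S ω f ∈ PW S (2 * ω) := by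
  intro F hF hFc hF0
  have hFv : VanishesAtTop F := by
    refine ⟨hF, ?_⟩
    obtain ⟨M, hM⟩ := hFc.isCompact.bddAbove
    refine ⟨M + 1, fun l hl => ?_⟩
    by_contra h
    linarith [hM (subset_tsupport F h)]
  have h := funCalc_mul (S := S) hFv (vanishesAtTop_cutoff hω)
  rw [funCalc_eq_zero (F := fun l => F l * cutoff ω l)] at h
  · exact congrArg (fun B : H →L[ℂ] H => B f) h
  · intro l
    rcases le_total l (2 * ω) with hl | hl
    · rw [hF0 l hl, zero_mul]
    · rw [cutoff_eq_zero hω hl, mul_zero]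

theorem norm_lowPass_le (hS : IsSelfAdjoint S) (h0 : IsNonneg S) (ω : ℝ) (f : H) :
    ‖lowPass S ω f‖ ≤ ‖f‖ := by
  have h : ‖lowPass S ω‖ ≤ 1 := norm_funCalc_le hS h0 zero_le_one fun l _ => by
    rw [abs_of_nonneg (cutoff_nonneg _ _)]
    exact cutoff_le_one _ _
  simpa using (lowPass S ω).le_of_opNorm_le h f

theorem symbol_cutoff_mem (ω x : ℝ) : symbol (cutoff ω) x ∈ Set.Icc (0 : ℝ) 1 := by
  unfold symbol
  split_ifs
  · exact ⟨cutoff_nonneg _ _, cutoff_le_one _ _⟩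
  · simp

theorem one_sub_lowPass (hS : IsSelfAdjoint S) (h0 : IsNonneg S) {ω : ℝ} (hω : 0 < ω) :
    1 - lowPass S ω = cfc (fun x => 1 - symbol (cutoff ω) x) (invOneAdd S) :=
  one_sub_cfc (isSelfAdjoint_invOneAdd hS h0) ((vanishesAtTop_cutoff hω).continuousOn_symbol _)

theorem norm_sub_lowPass_le (hS : IsSelfAdjoint S) (h0 : IsNonneg S) {ω : ℝ} (hω : 0 < ω)
    (f : H) : ‖f - lowPass S ω f‖ ≤ ‖f‖ := by
  have h : ‖1 - lowPass S ω‖ ≤ 1 := by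
    rw [one_sub_lowPass hS h0 hω]
    refine norm_cfc_le zero_le_one fun x _ => ?_
    obtain ⟨h1, h2⟩ := symbol_cutoff_mem ω x
    rw [Real.norm_eq_abs, abs_le]
    constructor <;> linarith
  simpa using (1 - lowPass S ω).le_of_opNorm_le h f

/-- Jackson's inequality for the operator `lowPass`. -/
theorem norm_sub_lowPass_le_ppow (hS : IsSelfAdjoint S) (h0 : IsNonneg S) {ω : ℝ} (hω : 0 < ω)
    (n : ℕ) (g : (ppow S n).domain) :
    ‖(g : H) - lowPass S ω g‖ ≤ (ω ^ n)⁻¹ * ‖ppow S n g‖ := by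
  have hR := isResolvent_invOneAdd hS h0
  obtain ⟨g, hg⟩ := g
  obtain ⟨h, rfl⟩ := (hR.mem_ppow_domain_iff n).1 hg
  have e1 := (hR.ppow_pow_apply n h).2
  simp only [e1]
  set m := symbol (cutoff ω) with hm
  have hmc : Continuous m := continuous_symbol (continuous_cutoff ω) fun _ => cutoff_eq_zero hω
  -- `k` is `(1 - m) l ^ (-n)` for the spectral variable `l = (1 - x) / x` of `S`; the maximum
  -- takes effect only for `l < ω`, where `1 - m` vanishes
  set k : ℝ → ℝ := fun x => (1 - m x) * (x / max (1 - x) (ω / (1 + ω))) ^ n with hk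
  have hω1 : 0 < 1 + ω := by linarith
  have hδ : 0 < ω / (1 + ω) := div_pos hω hω1
  have hkc : Continuous k := by
    refine (continuous_const.sub hmc).mul (Continuous.pow (Continuous.div continuous_id
      (by fun_prop) fun x => ?_) n)
    exact (hδ.trans_le (le_max_right _ _)).ne'
  have hone : ∀ x ∈ spectrum ℝ (invOneAdd S), 1 - x < ω / (1 + ω) → m x = 1 := by
    intro x hx hlt
    rw [lt_div_iff₀ hω1] at hlt
    have hx0 : 0 < x := by nlinarith
    rw [hm, symbol, if_pos hx0]
    exact cutoff_eq_one hω (by rw [div_le_iff₀ hx0]; nlinarith)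
  have e2 : (1 - lowPass S ω) * invOneAdd S ^ n
      = cfc k (invOneAdd S) * (1 - invOneAdd S) ^ n := by
    rw [one_sub_lowPass hS h0 hω, pow_invOneAdd_eq hS h0, one_sub_invOneAdd_pow_eq hS h0,
      cfc_mul_cfc_eq (f := fun x => 1 - m x) (h := fun x => (1 - m x) * x ^ n)
        ((continuous_const.sub hmc).continuousOn) (by fun_prop) fun x _ => rfl]
    refine (cfc_mul_cfc_eq hkc.continuousOn (by fun_prop) fun x hx => ?_).symm
    rcases lt_or_ge (1 - x) (ω / (1 + ω)) with hlt | hge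
    · simp [hk, hone x hx hlt]
    · have : 0 < 1 - x := hδ.trans_le hge
      simp only [hk, max_eq_left hge]
      rw [mul_assoc, ← mul_pow, div_mul_cancel₀ _ this.ne']
  have e3 : ‖cfc k (invOneAdd S)‖ ≤ (ω ^ n)⁻¹ := by
    refine norm_cfc_le (by positivity) fun x hx => ?_
    obtain ⟨hx0, hx1⟩ := spectrum_invOneAdd hS h0 hx
    rcases lt_or_ge (1 - x) (ω / (1 + ω)) with hlt | hge
    · simp only [hk, hone x hx hlt, sub_self, zero_mul, norm_zero]
      positivity
    · have hpos : 0 < 1 - x := hδ.trans_le hge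
      obtain ⟨h1, h2⟩ := symbol_cutoff_mem ω x
      have h3 : x / (1 - x) ≤ ω⁻¹ := by
        rw [div_le_iff₀ hω1] at hge
        rw [div_le_iff₀ hpos, ← div_eq_inv_mul, le_div_iff₀ hω]
        linarith
      simp only [hk, max_eq_left hge, norm_mul, norm_pow, Real.norm_eq_abs]
      rw [abs_of_nonneg (div_nonneg hx0 hpos.le), abs_of_nonneg (sub_nonneg.2 h2), ← inv_pow]
      calc (1 - m x) * (x / (1 - x)) ^ n ≤ 1 * (ω⁻¹) ^ n := by
            gcongr
            linarith
        _ = _ := one_mul _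
  have e4 : (invOneAdd S ^ n) h - lowPass S ω ((invOneAdd S ^ n) h)
      = cfc k (invOneAdd S) (((1 - invOneAdd S) ^ n) h) :=
    congrArg (fun B : H →L[ℂ] H => B h) e2
  rw [e4]
  exact (cfc k (invOneAdd S)).le_of_opNorm_le e3 _

/-- `φ_n(S) g` does not depend on `n ≥ ω` for `g ∈ PW_ω(S)`, since `φ_n - φ_ω` has compact support
in `[ω, ∞)`; and `φ_n(S)` tends to the identity as `n → ∞`. -/
theorem lowPass_eq_self (hS : IsSelfAdjoint S) (h0 : IsNonneg S) {ω : ℝ} (hω : 0 < ω) {g : H}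
    (hg : g ∈ PW S ω) : lowPass S ω g = g := by
  have hR := isResolvent_invOneAdd hS h0
  set R := invOneAdd S
  have h1 : ∀ n, ω ≤ n → lowPass S n g = lowPass S ω g := by
    intro n hn
    have hn0 := hω.trans_le hn
    have h2 := hg (fun l => cutoff n l - cutoff ω l)
      ((continuous_cutoff n).sub (continuous_cutoff ω))
      (HasCompactSupport.intro (isCompact_Icc (a := ω) (b := 2 * n)) fun l hl => by
        rcases le_total l ω with h | h
        · rw [cutoff_eq_one hω h, cutoff_eq_one hn0 (h.trans hn), sub_self]
        · have h3 : 2 * n ≤ l := by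
            by_contra h4
            exact hl ⟨h, (not_le.1 h4).le⟩
          rw [cutoff_eq_zero hn0 h3, cutoff_eq_zero hω (by linarith), sub_self])
      (fun l hl => by rw [cutoff_eq_one hω hl, cutoff_eq_one hn0 (hl.trans hn), sub_self])
    rw [← funCalc_sub (vanishesAtTop_cutoff hn0) (vanishesAtTop_cutoff hω)] at h2
    exact sub_eq_zero.1 h2
  -- `R g` is in the domain of `S`, so that `lowPass S n (R g)` tends to `R g` as `n → ∞`
  have hd : (R ^ 1) g ∈ (ppow S 1).domain := (hR.ppow_pow_apply 1 g).1
  have hcomm0 : ∀ n, Commute (lowPass S n) R := fun n => by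
    have h := cfc_commute_cfc (symbol (cutoff n)) (fun x : ℝ => x) R
    rwa [cfc_id' ℝ R (isSelfAdjoint_invOneAdd hS h0)] at h
  have hcomm : ∀ n, lowPass S n (R g) = R (lowPass S n g) := fun n =>
    congrArg (fun B : H →L[ℂ] H => B g) (hcomm0 n).eq
  have h2 : ∀ n, ω ≤ n → ‖R (g - lowPass S ω g)‖ ≤ n⁻¹ * ‖ppow S 1 ⟨_, hd⟩‖ := by
    intro n hn
    have h3 := norm_sub_lowPass_le_ppow hS h0 (hω.trans_le hn) 1 ⟨_, hd⟩
    simp only [pow_one] at h3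
    rwa [hcomm, h1 n hn, ← map_sub] at h3
  have h3 : ‖R (g - lowPass S ω g)‖ ≤ 0 := by
    refine ge_of_tendsto (f := fun n : ℝ => n⁻¹ * ‖ppow S 1 ⟨_, hd⟩‖) (x := Filter.atTop) ?_
      (Filter.eventually_ge_atTop ω |>.mono h2)
    simpa using tendsto_inv_atTop_zero.mul_const ‖ppow S 1 ⟨_, hd⟩‖
  have h4 := (injective_iff_map_eq_zero R).1 hR.injective _ (norm_le_zero_iff.1 h3)
  exact (sub_eq_zero.1 h4).symm

/-- The function on the left is the symbol of `S ^ n (lowPass S ω)`, see `ppow_lowPass_apply`. -/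
theorem norm_ppow_lowPass_le (hS : IsSelfAdjoint S) (h0 : IsNonneg S) {ω : ℝ} (hω : 0 < ω)
    (n : ℕ) (f : H) : ‖funCalc S (fun l => l ^ n * cutoff ω l) f‖ ≤ (2 * ω) ^ n * ‖f‖ := by
  refine (funCalc S _).le_of_opNorm_le (norm_funCalc_le hS h0 (by positivity) fun l hl => ?_) f
  rw [abs_of_nonneg (mul_nonneg (pow_nonneg hl n) (cutoff_nonneg _ _))]
  rcases le_total l (2 * ω) with h | h
  · calc l ^ n * cutoff ω l ≤ (2 * ω) ^ n * 1 := by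
          gcongr
          exacts [cutoff_nonneg _ _, cutoff_le_one _ _]
      _ = _ := mul_one _
  · rw [cutoff_eq_zero hω h, mul_zero]
    positivity

end JacksonBernstein

/-! ### Best approximation and the low-pass operators -/

section BestApproximation

variable {H : Type*} [NormedAddCommGroup H] [InnerProductSpace ℂ H] [CompleteSpace H]
  {S : H →ₗ.[ℂ] H}

theorem bestApprox_nonneg (f : H) (ω : ℝ) : 0 ≤ bestApprox S f ω :=
  Real.iInf_nonneg fun _ => norm_nonneg _

theorem bestApprox_le {f g : H} {ω : ℝ} (hg : g ∈ PW S ω) : bestApprox S f ω ≤ ‖f - g‖ :=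
  ciInf_le ⟨0, by rintro _ ⟨g, rfl⟩; exact norm_nonneg _⟩ (⟨g, hg⟩ : PW S ω)

theorem bestApprox_le_norm_sub_lowPass {ω : ℝ} (hω : 0 < ω) (f : H) :
    bestApprox S f ω ≤ ‖f - lowPass S (ω / 2) f‖ := by
  have h := lowPass_mem_PW (S := S) (half_pos hω) f
  rw [mul_div_cancel₀ _ two_ne_zero] at h
  exact bestApprox_le h

theorem norm_sub_lowPass_le_bestApprox (hS : IsSelfAdjoint S) (h0 : IsNonneg S) {ω : ℝ}
    (hω : 0 < ω) (f : H) : ‖f - lowPass S ω f‖ ≤ bestApprox S f ω := by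
  refine le_ciInf fun g => ?_
  have h := norm_sub_lowPass_le hS h0 hω (f - g)
  rw [map_sub, lowPass_eq_self hS h0 hω g.2] at h
  simpa using h

/-- The sequence `‖f‖, 𝓔(f, 1), 𝓔(f, 2), 𝓔(f, 4), …`. -/
def approxSeq (S : H →ₗ.[ℂ] H) (f : H) : ℕ → ℝ
  | 0 => ‖f‖
  | j + 1 => bestApprox S f (2 ^ j)

theorem approxSeq_nonneg (f : H) (j : ℕ) : 0 ≤ approxSeq S f j := by
  cases j
  exacts [norm_nonneg _, bestApprox_nonneg _ _]

theorem norm_sub_lowPass_le_approxSeq (hS : IsSelfAdjoint S) (h0 : IsNonneg S) (f : H) (j : ℕ) :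
    ‖f - lowPass S (2 ^ j / 2) f‖ ≤ approxSeq S f j := by
  cases j with
  | zero => exact norm_sub_lowPass_le hS h0 (by positivity) f
  | succ j =>
    rw [pow_succ, mul_div_cancel_right₀ _ two_ne_zero]
    exact norm_sub_lowPass_le_bestApprox hS h0 (by positivity) f

theorem approxSeq_succ_le (hS : IsSelfAdjoint S) (h0 : IsNonneg S) (f : H) (j : ℕ) :
    approxSeq S f (j + 1) ≤ approxSeq S f j :=
  (bestApprox_le_norm_sub_lowPass (by positivity) f).trans
    (norm_sub_lowPass_le_approxSeq hS h0 f j)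

theorem ppow_lowPass_apply (hS : IsSelfAdjoint S) (h0 : IsNonneg S) {ω : ℝ} (hω : 0 < ω)
    (n : ℕ) (f : H) : ∃ hf : lowPass S ω f ∈ (ppow S n).domain,
      ppow S n ⟨lowPass S ω f, hf⟩ = funCalc S (fun l => l ^ n * cutoff ω l) f :=
  ppow_funCalc_apply hS h0 (vanishesAtTop_cutoff hω) n f

theorem lowPass_mem_ppow_domain (hS : IsSelfAdjoint S) (h0 : IsNonneg S) {ω : ℝ} (hω : 0 < ω)
    (n : ℕ) (f : H) : lowPass S ω f ∈ (ppow S n).domain :=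
  (ppow_lowPass_apply hS h0 hω n f).1

/-- Bernstein's inequality. -/
theorem norm_ppow_le_of_mem_PW (hS : IsSelfAdjoint S) (h0 : IsNonneg S) {ω : ℝ} (hω : 0 < ω)
    {g : H} (hg : g ∈ PW S ω) (n : ℕ) (hd : g ∈ (ppow S n).domain) :
    ‖ppow S n ⟨g, hd⟩‖ ≤ (2 * ω) ^ n * ‖g‖ := by
  obtain ⟨h1, h2⟩ := ppow_lowPass_apply hS h0 hω n g
  rw [ppow_congr hd (lowPass_eq_self hS h0 hω hg).symm h1, h2]
  exact norm_ppow_lowPass_le hS h0 hω n g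

theorem PW_mono {ω ω' : ℝ} (h : ω ≤ ω') : PW S ω ≤ PW S ω' :=
  fun _ hf F h1 h2 h3 => hf F h1 h2 fun l hl => h3 l (hl.trans h)

/-- The dyadic decomposition of `lowPass` and Bernstein's inequality for its pieces. -/
theorem norm_ppow_lowPass_le_sum (hS : IsSelfAdjoint S) (h0 : IsNonneg S) (n : ℕ) (f : H) (j : ℕ)
    (hd : lowPass S (2 ^ j / 2) f ∈ (ppow S n).domain) :
    ‖ppow S n ⟨_, hd⟩‖ ≤ ‖f‖ + 2 * 4 ^ n *
      ∑ i ∈ Finset.range j, (2 ^ n) ^ i * approxSeq S f i := by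
  induction j with
  | zero =>
    obtain ⟨h1, h2⟩ := ppow_lowPass_apply hS h0 (ω := (2 : ℝ) ^ 0 / 2) (by positivity) n f
    have h3 := norm_ppow_lowPass_le hS h0 (ω := (2 : ℝ) ^ 0 / 2) (by positivity) n f
    rw [← h2] at h3
    simpa using h3
  | succ j ih =>
    have hj := lowPass_mem_ppow_domain hS h0 (ω := 2 ^ j / 2) (by positivity) n f
    set u : (ppow S n).domain := ⟨_, hd⟩
    set v : (ppow S n).domain := ⟨_, hj⟩
    have hu : (u : H) ∈ PW S (2 ^ (j + 1)) := by
      have := lowPass_mem_PW (S := S) (ω := 2 ^ (j + 1) / 2) (by positivity) f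
      rwa [mul_div_cancel₀ _ two_ne_zero] at this
    have hv : (v : H) ∈ PW S (2 ^ (j + 1)) := by
      have := lowPass_mem_PW (S := S) (ω := 2 ^ j / 2) (by positivity) f
      rw [mul_div_cancel₀ _ two_ne_zero] at this
      exact PW_mono (by gcongr <;> norm_num) this
    have h1 := norm_ppow_le_of_mem_PW hS h0 (by positivity) (sub_mem hu hv) n (u - v).2
    have h2 : ‖(u : H) - v‖ ≤ 2 * approxSeq S f j := by
      have h3 := norm_sub_lowPass_le_approxSeq hS h0 f (j + 1)
      have h4 := norm_sub_lowPass_le_approxSeq hS h0 f j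
      have h5 := approxSeq_succ_le hS h0 f j
      have h6 := norm_sub_le (f - (v : H)) (f - u)
      rw [sub_sub_sub_cancel_left] at h6
      linarith
    have h3 : ppow S n ⟨(u : H) - v, (u - v).2⟩ = ppow S n u - ppow S n v := (ppow S n).map_sub u v
    rw [h3] at h1
    have h4 : ‖ppow S n u‖ ≤ ‖ppow S n u - ppow S n v‖ + ‖ppow S n v‖ := by
      simpa using norm_add_le (ppow S n u - ppow S n v) (ppow S n v)
    have h5 : (2 * 2 ^ (j + 1) : ℝ) ^ n = 4 ^ n * (2 ^ n) ^ j := by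
      rw [← pow_mul, mul_comm n j, pow_mul, ← mul_pow]
      congr 1
      ring
    rw [h5] at h1
    have h6 : (4 : ℝ) ^ n * (2 ^ n) ^ j * ‖(u : H) - v‖
        ≤ 4 ^ n * (2 ^ n) ^ j * (2 * approxSeq S f j) := by gcongr
    rw [Finset.sum_range_succ]
    linarith [ih hj]

end BestApproximation

/-! ### The `K`-functional -/

section KFunctional

variable {H : Type*} [NormedAddCommGroup H] [InnerProductSpace ℂ H]
  {V : Submodule ℂ H} {N : V → ℝ}

theorem KFunctional_bddBelow (hN : ∀ g, 0 ≤ N g) (f : H) {t : ℝ} (ht : 0 ≤ t) :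
    BddBelow (Set.range fun g : V => ‖f - (g : H)‖ + t * N g) :=
  ⟨0, by rintro _ ⟨g, rfl⟩; have := hN g; positivity⟩

theorem KFunctional_le (hN : ∀ g, 0 ≤ N g) (f : H) {t : ℝ} (ht : 0 ≤ t) (g : V) :
    KFunctional V N f t ≤ ‖f - (g : H)‖ + t * N g :=
  ciInf_le (KFunctional_bddBelow hN f ht) g

theorem le_mul_KFunctional {f : H} {t c C : ℝ} (hC : 0 < C)
    (h : ∀ g : V, c ≤ C * (‖f - (g : H)‖ + t * N g)) : c ≤ C * KFunctional V N f t := by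
  rw [← div_le_iff₀' hC]
  exact le_ciInf fun g => (div_le_iff₀' hC).2 (h g)

theorem KFunctional_mono (hN : ∀ g, 0 ≤ N g) (f : H) {s t : ℝ} (hs : 0 ≤ s) (hst : s ≤ t) :
    KFunctional V N f s ≤ KFunctional V N f t :=
  ciInf_mono (KFunctional_bddBelow hN f hs) fun g => by
    have := hN g
    gcongr

theorem KFunctional_mul_le (hN : ∀ g, 0 ≤ N g) (f : H) {t c : ℝ} (ht : 0 ≤ t) (hc : 1 ≤ c) :
    KFunctional V N f (c * t) ≤ c * KFunctional V N f t := by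
  refine le_mul_KFunctional (by linarith) fun g => ?_
  refine (KFunctional_le hN f (by positivity) g).trans ?_
  nlinarith [norm_nonneg (f - (g : H))]

theorem KFunctional_nonneg (hN : ∀ g, 0 ≤ N g) (f : H) {t : ℝ} (ht : 0 ≤ t) :
    0 ≤ KFunctional V N f t :=
  Real.iInf_nonneg fun g => by have := hN g; positivity

end KFunctional

/-! ### Direct and inverse estimates for the `K`-functional -/

section Comparison

variable {H : Type*} [NormedAddCommGroup H] [InnerProductSpace ℂ H]

/-- The norm `N` on `V` is equivalent to the graph norm of `A`, whose domain is `V`. -/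
structure IsEquivGraphNorm (A : H →ₗ.[ℂ] H) (V : Submodule ℂ H) (N : V → ℝ) (b B : ℝ) :
    Prop where
  domain_eq : V = A.domain
  pos : 0 < b
  pos' : 0 < B
  lower : ∀ (f : H) (h₁ : f ∈ V) (h₂ : f ∈ A.domain), b * graphNorm A ⟨f, h₂⟩ ≤ N ⟨f, h₁⟩
  upper : ∀ (f : H) (h₁ : f ∈ V) (h₂ : f ∈ A.domain), N ⟨f, h₁⟩ ≤ B * graphNorm A ⟨f, h₂⟩

namespace IsEquivGraphNorm

variable {A : H →ₗ.[ℂ] H} {V : Submodule ℂ H} {N : V → ℝ} {b B : ℝ}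

theorem nonneg (h : IsEquivGraphNorm A V N b B) (g : V) : 0 ≤ N g := by
  refine le_trans ?_ (h.lower g g.2 (h.domain_eq ▸ g.2))
  have := h.pos
  unfold graphNorm
  positivity

theorem KFunctional_le_norm (h : IsEquivGraphNorm A V N b B) (f : H) {t : ℝ} (ht : 0 ≤ t) :
    KFunctional V N f t ≤ ‖f‖ := by
  have h0 : N 0 ≤ 0 := by
    have h1 := h.upper 0 V.zero_mem A.domain.zero_mem
    have h2 : graphNorm A ⟨0, A.domain.zero_mem⟩ = 0 := by
      have : A ⟨0, A.domain.zero_mem⟩ = 0 := A.map_zero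
      simp [graphNorm, this]
    rw [h2, mul_zero] at h1
    exact h1
  have h1 := KFunctional_le h.nonneg f ht 0
  have h2 : t * N 0 ≤ 0 := mul_nonpos_of_nonneg_of_nonpos ht h0
  rw [Submodule.coe_zero, sub_zero] at h1
  linarith

theorem norm_le_mul_KFunctional (h : IsEquivGraphNorm A V N b B) (f : H) :
    ‖f‖ ≤ (1 + 1 / b) * KFunctional V N f 1 := by
  have hb := h.pos
  refine le_mul_KFunctional (by positivity) fun g => ?_
  have h1 := h.lower g g.2 (h.domain_eq ▸ g.2)
  have h2 : ‖(g : H)‖ ≤ 1 / b * N g := by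
    rw [div_mul_eq_mul_div, one_mul, le_div_iff₀' hb]
    refine le_trans ?_ h1
    gcongr
    exact le_add_of_nonneg_right (norm_nonneg _)
  have h3 : ‖f‖ ≤ ‖f - (g : H)‖ + ‖(g : H)‖ := by simpa using norm_add_le (f - (g : H)) g
  have h4 := h.nonneg g
  have h5 : 0 ≤ 1 / b * ‖f - (g : H)‖ := by positivity
  nlinarith

variable [CompleteSpace H] {S : H →ₗ.[ℂ] H} {r : ℕ}

/-- Jackson's theorem: the errors of best approximation are bounded by the `K`-functional. -/
theorem bestApprox_le_mul_KFunctional (hS : IsSelfAdjoint S) (h0 : IsNonneg S)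
    (h : IsEquivGraphNorm (ppow S r) V N b B) (f : H) (j : ℕ) :
    bestApprox S f (2 ^ j) ≤ (1 + 2 ^ r / b) * KFunctional V N f (((2 : ℝ) ^ r)⁻¹ ^ j) := by
  have hb := h.pos
  refine le_mul_KFunctional (by positivity) fun g => ?_
  set t : ℝ := ((2 : ℝ) ^ r)⁻¹ ^ j with ht
  have ht0 : 0 < t := by positivity
  have hg : (g : H) ∈ (ppow S r).domain := h.domain_eq ▸ g.2
  have h1 := bestApprox_le_norm_sub_lowPass (S := S) (ω := 2 ^ j) (by positivity) f
  have h2 := norm_sub_lowPass_le hS h0 (ω := 2 ^ j / 2) (by positivity) (f - (g : H))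
  have h3 := norm_sub_lowPass_le_ppow hS h0 (ω := 2 ^ j / 2) (by positivity) r ⟨g, hg⟩
  have e1 : (((2 : ℝ) ^ j / 2) ^ r)⁻¹ = 2 ^ r * t := by
    rw [ht, div_pow, inv_div, ← pow_mul, inv_pow, ← pow_mul, mul_comm r j, div_eq_mul_inv]
  rw [e1] at h3
  have h4 : ‖ppow S r ⟨g, hg⟩‖ ≤ N g / b := by
    rw [le_div_iff₀' hb]
    refine le_trans ?_ (h.lower g g.2 hg)
    gcongr
    exact le_add_of_nonneg_left (norm_nonneg _)
  have h5 : ‖f - lowPass S (2 ^ j / 2) f‖ ≤ ‖f - (g : H)‖ + 2 ^ r * t * (N g / b) := by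
    calc ‖f - lowPass S (2 ^ j / 2) f‖
        = ‖((f - g) - lowPass S (2 ^ j / 2) (f - g)) + (g - lowPass S (2 ^ j / 2) g)‖ := by
          rw [map_sub]
          congr 1
          abel
      _ ≤ ‖f - (g : H)‖ + 2 ^ r * t * ‖ppow S r ⟨g, hg⟩‖ :=
          (norm_add_le _ _).trans (add_le_add h2 h3)
      _ ≤ _ := by gcongr
  have h6 := h.nonneg g
  have h7 : 0 ≤ 2 ^ r / b * ‖f - (g : H)‖ := by positivity
  have h8 : 0 ≤ t * N g := by positivity
  calc bestApprox S f (2 ^ j) ≤ ‖f - (g : H)‖ + 2 ^ r * t * (N g / b) := h1.trans h5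
    _ = ‖f - (g : H)‖ + 2 ^ r / b * (t * N g) := by ring
    _ ≤ _ := by linarith

/-- The inverse theorem: the `K`-functional is bounded by the errors of best approximation. -/
theorem KFunctional_le_sum (hS : IsSelfAdjoint S) (h0 : IsNonneg S)
    (h : IsEquivGraphNorm (ppow S r) V N b B) (f : H) (j : ℕ) :
    KFunctional V N f (((2 : ℝ) ^ r)⁻¹ ^ j) ≤ (1 + B * (2 + 2 * 4 ^ r)) *
      (((2 : ℝ) ^ r)⁻¹ ^ j * ∑ i ∈ Finset.range (j + 1), (2 ^ r) ^ i * approxSeq S f i) := by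
  have hB := h.pos'
  set t : ℝ := ((2 : ℝ) ^ r)⁻¹ ^ j with ht
  have ht0 : 0 < t := by positivity
  have hd := lowPass_mem_ppow_domain hS h0 (ω := 2 ^ j / 2) (by positivity) r f
  have hV : lowPass S (2 ^ j / 2) f ∈ V := h.domain_eq ▸ hd
  have h1 := KFunctional_le h.nonneg f ht0.le ⟨_, hV⟩
  have h2 := h.upper _ hV hd
  have h3 := norm_sub_lowPass_le_approxSeq hS h0 f j
  have h4 := norm_ppow_lowPass_le_sum hS h0 r f j hd
  have h5 := norm_lowPass_le hS h0 (2 ^ j / 2) f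
  set σ := ∑ i ∈ Finset.range (j + 1), ((2 : ℝ) ^ r) ^ i * approxSeq S f i with hσ
  have hterm : ∀ i, 0 ≤ ((2 : ℝ) ^ r) ^ i * approxSeq S f i := fun i =>
    mul_nonneg (by positivity) (approxSeq_nonneg f i)
  have h6 : ((2 : ℝ) ^ r) ^ j * approxSeq S f j ≤ σ :=
    Finset.single_le_sum (f := fun i => ((2 : ℝ) ^ r) ^ i * approxSeq S f i)
      (fun i _ => hterm i) (Finset.self_mem_range_succ j)
  have h7 : ‖f‖ ≤ σ := by
    have h : ((2 : ℝ) ^ r) ^ 0 * approxSeq S f 0 ≤ σ :=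
      Finset.single_le_sum (f := fun i => ((2 : ℝ) ^ r) ^ i * approxSeq S f i)
        (fun i _ => hterm i) (Finset.mem_range.2 (Nat.succ_pos j))
    rwa [pow_zero, one_mul] at h
  have h8 : ∑ i ∈ Finset.range j, ((2 : ℝ) ^ r) ^ i * approxSeq S f i ≤ σ := by
    rw [hσ, Finset.sum_range_succ]
    exact le_add_of_nonneg_right (hterm j)
  have h9 : approxSeq S f j ≤ t * σ := by
    calc approxSeq S f j = t * (((2 : ℝ) ^ r) ^ j * approxSeq S f j) := by
          rw [ht, ← mul_assoc, ← mul_pow, inv_mul_cancel₀ (by positivity), one_pow, one_mul]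
      _ ≤ _ := by gcongr
  have h10 : N ⟨_, hV⟩ ≤ B * (σ + (σ + 2 * 4 ^ r * σ)) := by
    refine h2.trans ?_
    unfold graphNorm
    gcongr
    · exact h5.trans h7
    · exact h4.trans (by gcongr)
  calc _ ≤ _ := h1
    _ ≤ t * σ + t * (B * (σ + (σ + 2 * 4 ^ r * σ))) := by
        gcongr
        exact h3.trans h9
    _ = _ := by ring

end IsEquivGraphNorm

end Comparison

/-! ### Sequence norms and a discrete Hardy inequality -/

section SequenceNorm

/-- The `ℓ^q` norm of a sequence. -/
def seqNorm (q : ℝ≥0∞) (x : ℕ → ℝ≥0∞) : ℝ≥0∞ :=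
  if q = ⊤ then ⨆ j, x j else (∑' j, x j ^ q.toReal) ^ (1 / q.toReal)

theorem one_le_toReal {q : ℝ≥0∞} (hq : 1 ≤ q) (h : q ≠ ⊤) : 1 ≤ q.toReal := by
  rwa [← ENNReal.ofReal_le_iff_le_toReal h, ENNReal.ofReal_one]

theorem seqNorm_mono {q : ℝ≥0∞} {x y : ℕ → ℝ≥0∞} (h : ∀ j, x j ≤ y j) :
    seqNorm q x ≤ seqNorm q y := by
  unfold seqNorm
  split_ifs
  · exact iSup_mono h
  · gcongr with j
    exact h j

theorem seqNorm_const_mul {q : ℝ≥0∞} (hq : 1 ≤ q) (c : ℝ≥0∞) (x : ℕ → ℝ≥0∞) :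
    seqNorm q (fun j => c * x j) = c * seqNorm q x := by
  unfold seqNorm
  split_ifs with h
  · exact (ENNReal.mul_iSup _ _).symm
  · have hp : 0 < q.toReal := zero_lt_one.trans_le (one_le_toReal hq h)
    simp_rw [ENNReal.mul_rpow_of_nonneg _ _ hp.le]
    rw [ENNReal.tsum_mul_left, ENNReal.mul_rpow_of_nonneg _ _ (by positivity), ← ENNReal.rpow_mul,
      mul_one_div_cancel hp.ne', ENNReal.rpow_one]

theorem apply_le_seqNorm {q : ℝ≥0∞} (hq : 1 ≤ q) (x : ℕ → ℝ≥0∞) (j : ℕ) : x j ≤ seqNorm q x := by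
  unfold seqNorm
  split_ifs with h
  · exact le_iSup x j
  · have hp : 0 < q.toReal := zero_lt_one.trans_le (one_le_toReal hq h)
    rw [one_div, ENNReal.le_rpow_inv_iff hp]
    exact ENNReal.le_tsum (f := fun j => x j ^ q.toReal) j

theorem seqNorm_le_add {q : ℝ≥0∞} (hq : 1 ≤ q) (x : ℕ → ℝ≥0∞) :
    seqNorm q x ≤ x 0 + seqNorm q (fun j => x (j + 1)) := by
  unfold seqNorm
  split_ifs with h
  · refine iSup_le fun j => ?_
    cases j with
    | zero => exact le_self_add
    | succ j => exact le_add_left (le_iSup (fun j => x (j + 1)) j)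
  · have h1 := one_le_toReal hq h
    have hp : 0 < q.toReal := zero_lt_one.trans_le h1
    rw [tsum_eq_zero_add' ENNReal.summable]
    refine (ENNReal.rpow_add_le_add_rpow _ _ (by positivity)
      ((div_le_one hp).2 h1)).trans ?_
    rw [← ENNReal.rpow_mul, mul_one_div_cancel hp.ne', ENNReal.rpow_one]

theorem sum_pow_sub_le (ρ : ℝ≥0∞) (j : ℕ) :
    ∑ i ∈ Finset.range (j + 1), ρ ^ (j - i) ≤ (1 - ρ)⁻¹ := by
  rw [← ENNReal.tsum_geometric, ← Finset.sum_range_reflect]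
  refine le_trans (le_of_eq (Finset.sum_congr rfl fun i hi => ?_))
    (ENNReal.sum_le_tsum (Finset.range (j + 1)))
  rw [Finset.mem_range] at hi
  congr 1
  omega

/-- The discrete Hardy inequality: convolution with a geometric sequence is bounded in `ℓ^q`. -/
theorem seqNorm_conv_le {q : ℝ≥0∞} (hq : 1 ≤ q) (ρ : ℝ≥0∞) (x : ℕ → ℝ≥0∞) :
    seqNorm q (fun j => ∑ i ∈ Finset.range (j + 1), ρ ^ (j - i) * x i)
      ≤ (1 - ρ)⁻¹ * seqNorm q x := by
  unfold seqNorm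
  split_ifs with h
  · refine iSup_le fun j => ?_
    calc ∑ i ∈ Finset.range (j + 1), ρ ^ (j - i) * x i
        ≤ ∑ i ∈ Finset.range (j + 1), ρ ^ (j - i) * ⨆ j, x j := by
          gcongr with i
          exact le_iSup x i
      _ ≤ _ := by
          rw [← Finset.sum_mul]
          gcongr
          exact sum_pow_sub_le ρ j
  · have h1 := one_le_toReal hq h
    set p := q.toReal
    have hp : 0 < p := zero_lt_one.trans_le h1
    set W : ℝ≥0∞ := (1 - ρ)⁻¹ with hW
    have hstep : ∀ j, (∑ i ∈ Finset.range (j + 1), ρ ^ (j - i) * x i) ^ p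
        ≤ W ^ (p - 1) * ∑' i, if i ≤ j then ρ ^ (j - i) * x i ^ p else 0 := by
      intro j
      have h2 := ENNReal.inner_le_weight_mul_Lp_of_nonneg (Finset.range (j + 1)) h1
        (fun i => ρ ^ (j - i)) x
      have h3 : ∑ i ∈ Finset.range (j + 1), ρ ^ (j - i) * x i ^ p
          = ∑' i, if i ≤ j then ρ ^ (j - i) * x i ^ p else 0 := by
        rw [tsum_eq_sum (s := Finset.range (j + 1))]
        · refine Finset.sum_congr rfl fun i hi => ?_
          rw [if_pos (Finset.mem_range_succ_iff.1 hi)]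
        · intro i hi
          rw [if_neg (fun h => hi (Finset.mem_range_succ_iff.2 h))]
      calc _ ≤ _ := ENNReal.rpow_le_rpow h2 hp.le
        _ = (∑ i ∈ Finset.range (j + 1), ρ ^ (j - i)) ^ (p - 1)
            * ∑ i ∈ Finset.range (j + 1), ρ ^ (j - i) * x i ^ p := by
          rw [ENNReal.mul_rpow_of_nonneg _ _ hp.le, ← ENNReal.rpow_mul, ← ENNReal.rpow_mul,
            inv_mul_cancel₀ hp.ne', ENNReal.rpow_one, sub_mul, one_mul, inv_mul_cancel₀ hp.ne']
        _ ≤ _ := by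
          rw [h3]
          exact mul_le_mul' (ENNReal.rpow_le_rpow (sum_pow_sub_le ρ j) (by linarith)) le_rfl
    have hcol : ∀ i, ∑' j, (if i ≤ j then ρ ^ (j - i) * x i ^ p else 0) ≤ W * x i ^ p := by
      intro i
      rw [← Summable.sum_add_tsum_nat_add' (k := i) ENNReal.summable, Finset.sum_eq_zero, zero_add]
      · simp only [le_add_iff_nonneg_left, zero_le, if_true, add_tsub_cancel_right]
        rw [ENNReal.tsum_mul_right, ENNReal.tsum_geometric]
      · intro j hj
        rw [if_neg (not_le.2 (Finset.mem_range.1 hj))]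
    have hWp : W ^ (p - 1) * W = W ^ p := by
      have h1W : W ≠ 0 := ENNReal.inv_ne_zero.2 (ne_top_of_le_ne_top ENNReal.one_ne_top tsub_le_self)
      rcases eq_or_ne W ⊤ with hT | hT
      · rw [hT, ENNReal.top_rpow_of_pos hp, ENNReal.mul_top]
        simp [ENNReal.rpow_eq_zero_iff, h1]
      · nth_rewrite 2 [← ENNReal.rpow_one W]
        rw [← ENNReal.rpow_add _ _ h1W hT, sub_add_cancel]
    have htot : ∑' j, (∑ i ∈ Finset.range (j + 1), ρ ^ (j - i) * x i) ^ p
        ≤ W ^ p * ∑' i, x i ^ p := by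
      calc _ ≤ ∑' j, W ^ (p - 1) * ∑' i, if i ≤ j then ρ ^ (j - i) * x i ^ p else 0 :=
            ENNReal.tsum_le_tsum hstep
        _ = W ^ (p - 1) * ∑' i, ∑' j, if i ≤ j then ρ ^ (j - i) * x i ^ p else 0 := by
            rw [ENNReal.tsum_mul_left, ENNReal.tsum_comm]
        _ ≤ W ^ (p - 1) * ∑' i, W * x i ^ p := by
            gcongr with i
            exact hcol i
        _ = _ := by rw [ENNReal.tsum_mul_left, ← mul_assoc, hWp]
    calc _ ≤ (W ^ p * ∑' i, x i ^ p) ^ (1 / p) := ENNReal.rpow_le_rpow htot (by positivity)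
      _ = _ := by
        rw [ENNReal.mul_rpow_of_nonneg _ _ (by positivity), ← ENNReal.rpow_mul,
          mul_one_div_cancel hp.ne', ENNReal.rpow_one]

end SequenceNorm

/-! ### Discretization of the interpolation norm -/

section Discretization

open MeasureTheory

/-- The norm of `t ↦ t ^ (-θ) K(t)` in `L^q(dt/t)`. -/
def weightedNorm (θ : ℝ) (q : ℝ≥0∞) (K : ℝ → ℝ) : ℝ≥0∞ :=
  if q = ⊤ then
    ⨆ t : Set.Ioi (0 : ℝ), ENNReal.ofReal ((t : ℝ) ^ (-θ) * K t)
  else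
    (∫⁻ t in Set.Ioi (0 : ℝ),
      ENNReal.ofReal (t ^ (-θ) * K t) ^ q.toReal * ENNReal.ofReal t⁻¹) ^ (1 / q.toReal)

/-- The properties of `t ↦ K(f, t)` on which the discretization of the interpolation norm rests:
`K` is non-decreasing, `K(t) / t` is non-increasing, and `K` is bounded by a multiple of its
value at `1`. -/
structure IsKProfile (K : ℝ → ℝ) (C : ℝ) : Prop where
  nonneg : ∀ t, 0 ≤ t → 0 ≤ K t
  mono : ∀ s t, 0 ≤ s → s ≤ t → K s ≤ K t
  mul_le : ∀ c t, 1 ≤ c → 0 ≤ t → K (c * t) ≤ c * K t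
  le_one : ∀ t, 0 ≤ t → K t ≤ C * K 1

/-- The interval `(M⁻ʲ, M · M⁻ʲ]`. -/
def geomIoc (M : ℝ) (j : ℕ) : Set ℝ := Set.Ioc (M⁻¹ ^ j) (M * M⁻¹ ^ j)

variable {M : ℝ}

theorem pairwise_disjoint_geomIoc (hM : 1 < M) :
    Pairwise (Function.onFun Disjoint (geomIoc M)) := by
  have hM0 : 0 < M := by linarith
  rw [pairwise_disjoint_on]
  intro j k hjk
  rw [Set.disjoint_left]
  rintro t ⟨h1, _⟩ ⟨_, h2⟩
  have h3 : M⁻¹ ^ k ≤ M⁻¹ ^ (j + 1) :=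
    pow_le_pow_of_le_one (by positivity) (inv_le_one_of_one_le₀ hM.le) hjk
  have h4 : M * M⁻¹ ^ (j + 1) = M⁻¹ ^ j := by
    rw [pow_succ]; field_simp
  have h5 : M * M⁻¹ ^ k ≤ M * M⁻¹ ^ (j + 1) := by gcongr
  linarith

theorem geomIoc_subset_Ioi (hM : 1 < M) (j : ℕ) : geomIoc M j ⊆ Set.Ioi 0 := fun _ ht =>
  lt_trans (pow_pos (inv_pos.2 (by linarith)) j) ht.1

theorem exists_mem_geomIoc (hM : 1 < M) {t : ℝ} (h0 : 0 < t) (h1 : t ≤ M) :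
    ∃ j, t ∈ geomIoc M j := by
  have hM0 : 0 < M := by linarith
  obtain ⟨j, h2, h3⟩ := exists_nat_pow_near_of_lt_one (div_pos h0 hM0) ((div_le_one hM0).2 h1)
    (inv_pos.2 hM0) (inv_lt_one_of_one_lt₀ hM)
  refine ⟨j, ?_, by rwa [div_le_iff₀' hM0] at h3⟩
  rwa [lt_div_iff₀ hM0, pow_succ, mul_assoc, inv_mul_cancel₀ hM0.ne', mul_one] at h2

variable {K : ℝ → ℝ} {C θ : ℝ}

/-- The values of `t ^ (-θ) K(t)` on the geometric grid `M⁻ʲ`. -/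
def gridSeq (M θ : ℝ) (K : ℝ → ℝ) (j : ℕ) : ℝ := (M⁻¹ ^ j) ^ (-θ) * K (M⁻¹ ^ j)

theorem IsKProfile.le_gridSeq (h : IsKProfile K C) (hM : 1 < M) (hθ : 0 ≤ θ) {j : ℕ} {t : ℝ}
    (ht : t ∈ geomIoc M j) : t ^ (-θ) * K t ≤ M * gridSeq M θ K j := by
  have hτ : 0 < M⁻¹ ^ j := pow_pos (inv_pos.2 (by linarith)) j
  have ht0 : 0 < t := hτ.trans ht.1
  calc t ^ (-θ) * K t ≤ (M⁻¹ ^ j) ^ (-θ) * (M * K (M⁻¹ ^ j)) := by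
        refine mul_le_mul ?_ ((h.mono _ _ ht0.le ht.2).trans (h.mul_le _ _ hM.le hτ.le))
          (h.nonneg _ ht0.le) (Real.rpow_nonneg hτ.le _)
        exact Real.rpow_le_rpow_of_nonpos hτ ht.1.le (neg_nonpos.2 hθ)
    _ = _ := by unfold gridSeq; ring

theorem IsKProfile.gridSeq_le (h : IsKProfile K C) (hM : 1 < M) (hθ : 0 ≤ θ) (hθ1 : θ ≤ 1)
    {j : ℕ} {t : ℝ} (ht : t ∈ geomIoc M j) : M⁻¹ * gridSeq M θ K j ≤ t ^ (-θ) * K t := by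
  have hM0 : 0 < M := by linarith
  have hτ : 0 < M⁻¹ ^ j := pow_pos (inv_pos.2 (by linarith)) j
  have ht0 : 0 < t := hτ.trans ht.1
  have h1 : M⁻¹ * (M⁻¹ ^ j) ^ (-θ) ≤ t ^ (-θ) := by
    calc M⁻¹ * (M⁻¹ ^ j) ^ (-θ) ≤ M ^ (-θ) * (M⁻¹ ^ j) ^ (-θ) := by
          have := Real.rpow_le_rpow_of_exponent_le hM.le (neg_le_neg hθ1)
          rw [Real.rpow_neg_one] at this
          gcongr
      _ = (M * M⁻¹ ^ j) ^ (-θ) := (Real.mul_rpow hM0.le hτ.le).symm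
      _ ≤ _ := Real.rpow_le_rpow_of_nonpos ht0 ht.2 (neg_nonpos.2 hθ)
  calc M⁻¹ * gridSeq M θ K j = M⁻¹ * (M⁻¹ ^ j) ^ (-θ) * K (M⁻¹ ^ j) := by unfold gridSeq; ring
    _ ≤ _ := mul_le_mul h1 (h.mono _ _ hτ.le ht.1.le) (h.nonneg _ hτ.le)
        (Real.rpow_nonneg ht0.le _)

theorem volume_geomIoc (M : ℝ) (j : ℕ) :
    volume (geomIoc M j) = ENNReal.ofReal ((M - 1) * M⁻¹ ^ j) := by
  rw [geomIoc, Real.volume_Ioc]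
  congr 1
  ring

/-- The lower half of the discretization: on each interval of the geometric partition
`t ^ (-θ) K(t)` is bounded below by a multiple of its value on the grid. -/
theorem exists_mul_seqNorm_le_weightedNorm (hM : 1 < M) (hθ : 0 ≤ θ) (hθ1 : θ ≤ 1) {q : ℝ≥0∞}
    (hq : 1 ≤ q) (C : ℝ) : ∃ κ : ℝ≥0∞, κ ≠ 0 ∧ κ ≠ ⊤ ∧ ∀ K, IsKProfile K C →
      κ * seqNorm q (fun j => ENNReal.ofReal (gridSeq M θ K j)) ≤ weightedNorm θ q K := by
  have hM0 : 0 < M := by linarith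
  by_cases hqt : q = ⊤
  · refine ⟨1, one_ne_zero, ENNReal.one_ne_top, fun K h => ?_⟩
    rw [one_mul, seqNorm, weightedNorm, if_pos hqt, if_pos hqt]
    refine iSup_le fun j => ?_
    exact le_iSup (fun t : Set.Ioi (0 : ℝ) => ENNReal.ofReal ((t : ℝ) ^ (-θ) * K t))
      ⟨M⁻¹ ^ j, pow_pos (inv_pos.2 hM0) j⟩
  have h1 := one_le_toReal hq hqt
  set p := q.toReal with hpdef
  have hp : 0 < p := zero_lt_one.trans_le h1
  set δ : ℝ≥0∞ := ENNReal.ofReal M⁻¹ ^ p * ENNReal.ofReal (1 - M⁻¹) with hδ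
  have hM1 : M⁻¹ < 1 := inv_lt_one_of_one_lt₀ hM
  have hδ0 : δ ≠ 0 := by
    refine mul_ne_zero ?_ ?_
    · simp [ENNReal.rpow_eq_zero_iff, hM0, hp, hp.le, not_lt]
    · simpa using hM1
  have hδt : δ ≠ ⊤ := ENNReal.mul_ne_top
    (ENNReal.rpow_ne_top_of_nonneg hp.le ENNReal.ofReal_ne_top) ENNReal.ofReal_ne_top
  refine ⟨δ ^ (1 / p), ?_, ENNReal.rpow_ne_top_of_nonneg (by positivity) hδt, fun K h => ?_⟩
  · simp [ENNReal.rpow_eq_zero_iff, hδ0, hδt]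
  rw [seqNorm, weightedNorm, if_neg hqt, if_neg hqt,
    ← ENNReal.mul_rpow_of_nonneg _ _ (by positivity)]
  refine ENNReal.rpow_le_rpow ?_ (by positivity)
  rw [← ENNReal.tsum_mul_left]
  have hpiece : ∀ j, δ * ENNReal.ofReal (gridSeq M θ K j) ^ p
      ≤ ∫⁻ t in geomIoc M j, ENNReal.ofReal (t ^ (-θ) * K t) ^ p * ENNReal.ofReal t⁻¹ := by
    intro j
    have hτ : 0 < M⁻¹ ^ j := pow_pos (inv_pos.2 (by linarith)) j
    have e1 : 1 - M⁻¹ = (M * M⁻¹ ^ j)⁻¹ * ((M - 1) * M⁻¹ ^ j) := by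
      field_simp
    calc δ * ENNReal.ofReal (gridSeq M θ K j) ^ p
        = ENNReal.ofReal (M⁻¹ * gridSeq M θ K j) ^ p * ENNReal.ofReal (M * M⁻¹ ^ j)⁻¹
            * volume (geomIoc M j) := by
          rw [hδ, volume_geomIoc, mul_assoc (ENNReal.ofReal (M⁻¹ * gridSeq M θ K j) ^ p),
            ← ENNReal.ofReal_mul (by positivity), ← e1,
            ENNReal.ofReal_mul (by positivity), ENNReal.mul_rpow_of_nonneg _ _ hp.le]
          ring
      _ = ∫⁻ t in geomIoc M j,
            ENNReal.ofReal (M⁻¹ * gridSeq M θ K j) ^ p * ENNReal.ofReal (M * M⁻¹ ^ j)⁻¹ :=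
          (setLIntegral_const _ _).symm
      _ ≤ _ := by
          refine setLIntegral_mono' measurableSet_Ioc fun t ht => ?_
          have ht0 : 0 < t := geomIoc_subset_Ioi hM j ht
          exact mul_le_mul' (ENNReal.rpow_le_rpow (ENNReal.ofReal_le_ofReal
            (h.gridSeq_le hM hθ hθ1 ht)) hp.le)
            (ENNReal.ofReal_le_ofReal (inv_anti₀ ht0 ht.2))
  calc _ ≤ ∑' j, ∫⁻ t in geomIoc M j,
        ENNReal.ofReal (t ^ (-θ) * K t) ^ p * ENNReal.ofReal t⁻¹ := ENNReal.tsum_le_tsum hpiece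
    _ = ∫⁻ t in ⋃ j, geomIoc M j, ENNReal.ofReal (t ^ (-θ) * K t) ^ p * ENNReal.ofReal t⁻¹ :=
        (lintegral_iUnion (fun _ => measurableSet_Ioc) (pairwise_disjoint_geomIoc hM) _).symm
    _ ≤ _ := lintegral_mono_set (Set.iUnion_subset (geomIoc_subset_Ioi hM))

/-- The upper half of the discretization. For `t > M` the bound of `K` by `C K(1)` suffices, as
`t ^ (-θ)` is in `L^q(dt/t)` near infinity. -/
theorem exists_weightedNorm_le_mul_seqNorm (hM : 1 < M) (hθ : 0 < θ) {q : ℝ≥0∞}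
    (hq : 1 ≤ q) {C : ℝ} (hC : 0 ≤ C) : ∃ κ : ℝ≥0∞, κ ≠ ⊤ ∧ ∀ K, IsKProfile K C →
      weightedNorm θ q K ≤ κ * seqNorm q (fun j => ENNReal.ofReal (gridSeq M θ K j)) := by
  have hM0 : 0 < M := by linarith
  have hgrid0 : ∀ K : ℝ → ℝ, gridSeq M θ K 0 = K 1 := fun K => by simp [gridSeq]
  by_cases hqt : q = ⊤
  · refine ⟨ENNReal.ofReal M + ENNReal.ofReal C, by simp, fun K h => ?_⟩
    set σ := seqNorm q (fun j => ENNReal.ofReal (gridSeq M θ K j)) with hσ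
    have hle : ∀ j, ENNReal.ofReal (gridSeq M θ K j) ≤ σ := apply_le_seqNorm hq _
    rw [weightedNorm, if_pos hqt]
    refine iSup_le fun ⟨t, ht⟩ => ?_
    rw [Set.mem_Ioi] at ht
    rcases le_or_gt t M with h1 | h1
    · obtain ⟨j, hj⟩ := exists_mem_geomIoc hM ht h1
      refine (ENNReal.ofReal_le_ofReal (h.le_gridSeq hM hθ.le hj)).trans ?_
      rw [ENNReal.ofReal_mul hM0.le]
      exact mul_le_mul' le_self_add (hle j)
    · have h2 : t ^ (-θ) * K t ≤ C * gridSeq M θ K 0 := by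
        rw [hgrid0]
        calc t ^ (-θ) * K t ≤ 1 * K t := by
              gcongr
              · exact h.nonneg t ht.le
              · exact Real.rpow_le_one_of_one_le_of_nonpos (by linarith) (by linarith)
          _ ≤ _ := by rw [one_mul]; exact h.le_one t ht.le
      refine (ENNReal.ofReal_le_ofReal h2).trans ?_
      rw [ENNReal.ofReal_mul hC]
      exact mul_le_mul' le_add_self (hle 0)
  have h1 := one_le_toReal hq hqt
  set p := q.toReal with hpdef
  have hp : 0 < p := zero_lt_one.trans_le h1
  set T : ℝ≥0∞ := ∫⁻ t in Set.Ioi M, ENNReal.ofReal (t ^ (-θ * p - 1)) with hT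
  have hTt : T ≠ ⊤ := by
    refine (IntegrableOn.setLIntegral_lt_top (integrableOn_Ioi_rpow_of_lt ?_ hM0)).ne
    nlinarith
  set D : ℝ≥0∞ := ENNReal.ofReal M ^ p * ENNReal.ofReal (M - 1) + ENNReal.ofReal C ^ p * T with hD
  have hDt : D ≠ ⊤ := ENNReal.add_ne_top.2 ⟨ENNReal.mul_ne_top
    (ENNReal.rpow_ne_top_of_nonneg hp.le ENNReal.ofReal_ne_top) ENNReal.ofReal_ne_top,
    ENNReal.mul_ne_top (ENNReal.rpow_ne_top_of_nonneg hp.le ENNReal.ofReal_ne_top) hTt⟩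
  refine ⟨D ^ (1 / p), ENNReal.rpow_ne_top_of_nonneg (by positivity) hDt, fun K h => ?_⟩
  rw [seqNorm, weightedNorm, if_neg hqt, if_neg hqt,
    ← ENNReal.mul_rpow_of_nonneg _ _ (by positivity)]
  refine ENNReal.rpow_le_rpow ?_ (by positivity)
  set G : ℝ → ℝ≥0∞ := fun t => ENNReal.ofReal (t ^ (-θ) * K t) ^ p * ENNReal.ofReal t⁻¹ with hG
  have hpiece : ∀ j, ∫⁻ t in geomIoc M j, G t
      ≤ ENNReal.ofReal M ^ p * ENNReal.ofReal (M - 1) * ENNReal.ofReal (gridSeq M θ K j) ^ p := by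
    intro j
    have hτ : 0 < M⁻¹ ^ j := pow_pos (inv_pos.2 (by linarith)) j
    calc ∫⁻ t in geomIoc M j, G t
        ≤ ∫⁻ t in geomIoc M j,
            ENNReal.ofReal (M * gridSeq M θ K j) ^ p * ENNReal.ofReal (M⁻¹ ^ j)⁻¹ := by
          refine setLIntegral_mono' measurableSet_Ioc fun t ht => ?_
          have ht0 : 0 < t := geomIoc_subset_Ioi hM j ht
          exact mul_le_mul' (ENNReal.rpow_le_rpow (ENNReal.ofReal_le_ofReal
            (h.le_gridSeq hM hθ.le ht)) hp.le)
            (ENNReal.ofReal_le_ofReal (inv_anti₀ hτ ht.1.le))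
      _ = ENNReal.ofReal (M * gridSeq M θ K j) ^ p * ENNReal.ofReal (M⁻¹ ^ j)⁻¹
            * volume (geomIoc M j) := setLIntegral_const _ _
      _ = _ := by
          have e1 : (M⁻¹ ^ j)⁻¹ * ((M - 1) * M⁻¹ ^ j) = M - 1 := by
            field_simp
          rw [volume_geomIoc, mul_assoc, ← ENNReal.ofReal_mul (by positivity), e1,
            ENNReal.ofReal_mul (by positivity), ENNReal.mul_rpow_of_nonneg _ _ hp.le]
          ring
  have htail : ∫⁻ t in Set.Ioi M, G t
      ≤ ENNReal.ofReal C ^ p * T * ENNReal.ofReal (gridSeq M θ K 0) ^ p := by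
    calc ∫⁻ t in Set.Ioi M, G t
        ≤ ∫⁻ t in Set.Ioi M, ENNReal.ofReal (C * K 1) ^ p * ENNReal.ofReal (t ^ (-θ * p - 1)) := by
          refine setLIntegral_mono' measurableSet_Ioi fun t ht => ?_
          have ht0 : 0 < t := hM0.trans ht
          have e1 : t ^ (-θ * p - 1) = (t ^ (-θ)) ^ p * t⁻¹ := by
            rw [← Real.rpow_mul ht0.le, Real.rpow_sub_one ht0.ne', div_eq_mul_inv]
          have e2 : ENNReal.ofReal ((t ^ (-θ)) ^ p) = ENNReal.ofReal (t ^ (-θ)) ^ p :=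
            (ENNReal.ofReal_rpow_of_nonneg (by positivity) hp.le).symm
          rw [e1, ENNReal.ofReal_mul (p := (t ^ (-θ)) ^ p) (by positivity), e2, ← mul_assoc]
          simp only [hG]
          rw [mul_comm (t ^ (-θ)), ENNReal.ofReal_mul (h.nonneg t ht0.le),
            ENNReal.mul_rpow_of_nonneg _ _ hp.le]
          gcongr
          exact h.le_one t ht0.le
      _ = ENNReal.ofReal (C * K 1) ^ p * T := lintegral_const_mul' _ _
          (ENNReal.rpow_ne_top_of_nonneg hp.le ENNReal.ofReal_ne_top)
      _ = _ := by
          rw [hgrid0, ENNReal.ofReal_mul hC, ENNReal.mul_rpow_of_nonneg _ _ hp.le]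
          ring
  have hcover : Set.Ioi (0 : ℝ) ⊆ (⋃ j, geomIoc M j) ∪ Set.Ioi M := by
    intro t ht
    rcases le_or_gt t M with h2 | h2
    · exact Or.inl (Set.mem_iUnion.2 (exists_mem_geomIoc hM ht h2))
    · exact Or.inr h2
  calc (∫⁻ t in Set.Ioi (0 : ℝ), G t) ≤ ∫⁻ t in (⋃ j, geomIoc M j) ∪ Set.Ioi M, G t :=
        lintegral_mono_set hcover
    _ ≤ (∑' j, ∫⁻ t in geomIoc M j, G t) + ∫⁻ t in Set.Ioi M, G t :=
        (lintegral_union_le _ _ _).trans (add_le_add (lintegral_iUnion_le _ _) le_rfl)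
    _ ≤ ENNReal.ofReal M ^ p * ENNReal.ofReal (M - 1)
          * (∑' j, ENNReal.ofReal (gridSeq M θ K j) ^ p)
        + ENNReal.ofReal C ^ p * T * ∑' j, ENNReal.ofReal (gridSeq M θ K j) ^ p := by
        refine add_le_add ?_ (htail.trans ?_)
        · rw [← ENNReal.tsum_mul_left]
          exact ENNReal.tsum_le_tsum hpiece
        · gcongr
          exact ENNReal.le_tsum (f := fun j => ENNReal.ofReal (gridSeq M θ K j) ^ p) 0
    _ = _ := by rw [hD, add_mul]

end Discretization

/-! ### Equivalence of the interpolation norm and the approximation functional -/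

section Equivalence

variable {H : Type*} [NormedAddCommGroup H] [InnerProductSpace ℂ H]

theorem equivalentNorms_of_le {X : Type*} {M N : X → ℝ≥0∞} {C D : ℝ≥0∞} (hC : C ≠ ⊤) (hD : D ≠ ⊤)
    (h₁ : ∀ f, M f ≤ C * N f) (h₂ : ∀ f, N f ≤ D * M f) : EquivalentNorms M N := by
  refine ⟨Set.ext fun f => ⟨fun h => ?_, fun h => ?_⟩, (C.toNNReal + 1)⁻¹, D.toNNReal + 1,
    by positivity, by positivity, fun f => ⟨?_, ?_⟩⟩
  · exact (h₂ f).trans_lt (ENNReal.mul_lt_top hD.lt_top h)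
  · exact (h₁ f).trans_lt (ENNReal.mul_lt_top hC.lt_top h)
  · rw [ENNReal.coe_inv (by positivity), ← ENNReal.div_eq_inv_mul]
    refine ENNReal.div_le_of_le_mul' ((h₁ f).trans ?_)
    rw [ENNReal.coe_add, ENNReal.coe_toNNReal hC]
    gcongr
    exact le_self_add
  · refine (h₂ f).trans ?_
    rw [ENNReal.coe_add, ENNReal.coe_toNNReal hD]
    gcongr
    exact le_self_add

variable {V : Submodule ℂ H} {N : V → ℝ} {b B : ℝ} {r : ℕ}

theorem IsEquivGraphNorm.isKProfile {A : H →ₗ.[ℂ] H} (h : IsEquivGraphNorm A V N b B) (f : H) :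
    IsKProfile (KFunctional V N f) (1 + 1 / b) where
  nonneg _ ht := KFunctional_nonneg h.nonneg f ht
  mono _ _ hs hst := KFunctional_mono h.nonneg f hs hst
  mul_le _ _ hc ht := KFunctional_mul_le h.nonneg f ht hc
  le_one _ ht := (h.KFunctional_le_norm f ht).trans (h.norm_le_mul_KFunctional f)

/-- On the grid `t = 2 ^ (-jr)` the weight `t ^ (-α/r)` is `2 ^ (jα)`. -/
theorem inv_two_pow_rpow (α : ℝ) (hr : r ≠ 0) (j : ℕ) :
    ((((2 : ℝ) ^ r)⁻¹ ^ j) ^ (-(α / r)) : ℝ) = ((2 : ℝ) ^ α) ^ j := by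
  have hr' : (r : ℝ) ≠ 0 := Nat.cast_ne_zero.2 hr
  rw [← Real.rpow_natCast 2 r, ← Real.rpow_neg zero_le_two, ← Real.rpow_mul_natCast zero_le_two,
    ← Real.rpow_mul zero_le_two, ← Real.rpow_mul_natCast zero_le_two]
  congr 1
  field_simp

variable [CompleteSpace H] {S : H →ₗ.[ℂ] H}

theorem approxNorm_eq (α : ℝ) (q : ℝ≥0∞) (f : H) :
    approxNorm S α q f = ENNReal.ofReal ‖f‖ + seqNorm q fun j =>
      ENNReal.ofReal ((2 : ℝ) ^ ((j : ℝ) * α) * bestApprox S f ((2 : ℝ) ^ j)) := rfl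

theorem two_rpow_mul (α : ℝ) (j : ℕ) : (2 : ℝ) ^ ((j : ℝ) * α) = ((2 : ℝ) ^ α) ^ j := by
  rw [mul_comm, Real.rpow_mul_natCast zero_le_two]

/-- The inverse theorem with the weights `2 ^ (jα)`: its sum becomes a convolution with the
geometric sequence of ratio `2 ^ (α - r) < 1`. -/
theorem IsEquivGraphNorm.gridSeq_le_conv (hS : IsSelfAdjoint S) (h0 : IsNonneg S)
    (h : IsEquivGraphNorm (ppow S r) V N b B) (hr : r ≠ 0) (α : ℝ) (f : H) (j : ℕ) :
    ENNReal.ofReal (gridSeq (2 ^ r) (α / r) (KFunctional V N f) j)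
      ≤ ENNReal.ofReal (1 + B * (2 + 2 * 4 ^ r)) * ∑ i ∈ Finset.range (j + 1),
        ENNReal.ofReal (2 ^ α * (2 ^ r)⁻¹) ^ (j - i)
          * ENNReal.ofReal ((2 ^ α) ^ i * approxSeq S f i) := by
  have hB := h.pos'
  set ρ : ℝ := 2 ^ α * (2 ^ r)⁻¹ with hρ
  have hρ0 : 0 ≤ ρ := by positivity
  have hx : ∀ i, 0 ≤ ((2 : ℝ) ^ α) ^ i * approxSeq S f i := fun i =>
    mul_nonneg (by positivity) (approxSeq_nonneg f i)
  have h1 : gridSeq (2 ^ r) (α / r) (KFunctional V N f) j ≤ (1 + B * (2 + 2 * 4 ^ r))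
      * ∑ i ∈ Finset.range (j + 1), ρ ^ (j - i) * ((2 ^ α) ^ i * approxSeq S f i) := by
    rw [gridSeq, inv_two_pow_rpow α hr]
    have h2 := h.KFunctional_le_sum hS h0 f j
    calc _ ≤ ((2 : ℝ) ^ α) ^ j * _ := mul_le_mul_of_nonneg_left h2 (by positivity)
      _ = (1 + B * (2 + 2 * 4 ^ r)) * ∑ i ∈ Finset.range (j + 1),
            ρ ^ j * ((2 ^ r) ^ i * approxSeq S f i) := by
          rw [← Finset.mul_sum, hρ, mul_pow]
          ring
      _ = _ := by
          congr 1
          refine Finset.sum_congr rfl fun i hi => ?_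
          have hij : i ≤ j := Finset.mem_range_succ_iff.1 hi
          have e : ρ ^ i * (2 ^ r) ^ i = ((2 : ℝ) ^ α) ^ i := by
            rw [← mul_pow, hρ, mul_assoc, inv_mul_cancel₀ (by positivity), mul_one]
          rw [← Nat.sub_add_cancel hij, pow_add, Nat.sub_add_cancel hij, ← e]
          ring
  refine (ENNReal.ofReal_le_ofReal h1).trans (le_of_eq ?_)
  rw [ENNReal.ofReal_mul (by positivity),
    ENNReal.ofReal_sum_of_nonneg fun i _ => mul_nonneg (by positivity) (hx i)]
  congr 1
  refine Finset.sum_congr rfl fun i _ => ?_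
  rw [ENNReal.ofReal_mul (by positivity), ENNReal.ofReal_pow hρ0]

theorem seqNorm_approxSeq_le {α : ℝ} (hα : 0 ≤ α) {q : ℝ≥0∞} (hq : 1 ≤ q) (f : H) :
    seqNorm q (fun j => ENNReal.ofReal ((2 ^ α) ^ j * approxSeq S f j))
      ≤ ENNReal.ofReal (2 ^ α) * approxNorm S α q f := by
  refine (seqNorm_le_add hq _).trans ?_
  rw [approxNorm_eq, mul_add]
  refine add_le_add ?_ (le_of_eq ?_)
  · rw [pow_zero, one_mul]
    refine le_mul_of_one_le_left zero_le ?_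
    rw [ENNReal.one_le_ofReal]
    exact Real.one_le_rpow one_le_two hα
  · rw [← seqNorm_const_mul hq]
    congr 1
    funext j
    rw [← ENNReal.ofReal_mul (by positivity), two_rpow_mul, pow_succ', mul_assoc]
    rfl

theorem IsEquivGraphNorm.approxNorm_le_seqNorm (hS : IsSelfAdjoint S) (h0 : IsNonneg S)
    (h : IsEquivGraphNorm (ppow S r) V N b B) (hr : r ≠ 0) (α : ℝ) {q : ℝ≥0∞} (hq : 1 ≤ q)
    (f : H) :
    approxNorm S α q f ≤ (ENNReal.ofReal (1 + 1 / b) + ENNReal.ofReal (1 + 2 ^ r / b)) *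
      seqNorm q fun j => ENNReal.ofReal (gridSeq (2 ^ r) (α / r) (KFunctional V N f) j) := by
  have hb := h.pos
  rw [approxNorm_eq, add_mul]
  refine add_le_add ?_ ?_
  · refine le_trans ?_ (mul_le_mul' le_rfl (apply_le_seqNorm hq _ 0))
    rw [← ENNReal.ofReal_mul (by positivity)]
    refine ENNReal.ofReal_le_ofReal ?_
    simpa [gridSeq] using h.norm_le_mul_KFunctional f
  · rw [← seqNorm_const_mul hq]
    refine seqNorm_mono fun j => ?_
    rw [← ENNReal.ofReal_mul (by positivity)]
    refine ENNReal.ofReal_le_ofReal ?_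
    rw [two_rpow_mul, gridSeq, inv_two_pow_rpow α hr, mul_left_comm]
    gcongr
    exact h.bestApprox_le_mul_KFunctional hS h0 f j

/-- The equivalence for an arbitrary norm on the domain of `S ^ r` equivalent to the graph norm. -/
theorem IsEquivGraphNorm.equivalentNorms (hS : IsSelfAdjoint S) (h0 : IsNonneg S)
    (h : IsEquivGraphNorm (ppow S r) V N b B) {α : ℝ} (hα : 0 < α) (hr : α < r) {q : ℝ≥0∞}
    (hq : 1 ≤ q) : EquivalentNorms (interpNorm V N (α / r) q) (approxNorm S α q) := by
  have hr0 : (0 : ℝ) < r := hα.trans hr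
  have hrn : r ≠ 0 := fun e => by simp [e] at hr0
  have hM : (1 : ℝ) < 2 ^ r := one_lt_pow₀ one_lt_two hrn
  have hθ : 0 < α / r := div_pos hα hr0
  have hθ1 : α / r ≤ 1 := (div_le_one hr0).2 hr.le
  have hb := h.pos
  obtain ⟨κ, hκ0, hκt, hκ⟩ :=
    exists_mul_seqNorm_le_weightedNorm hM hθ.le hθ1 hq (1 + 1 / b)
  obtain ⟨κ', hκt', hκ'⟩ :=
    exists_weightedNorm_le_mul_seqNorm hM hθ hq (C := 1 + 1 / b) (by positivity)
  set ρ : ℝ := 2 ^ α * (2 ^ r)⁻¹ with hρ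
  have hρ1 : ENNReal.ofReal ρ < 1 := by
    rw [ENNReal.ofReal_lt_one, hρ, ← div_eq_mul_inv, div_lt_one (by positivity),
      ← Real.rpow_natCast 2 r]
    exact Real.rpow_lt_rpow_of_exponent_lt one_lt_two hr
  have hρt : (1 - ENNReal.ofReal ρ)⁻¹ ≠ ⊤ := ENNReal.inv_ne_top.2 (tsub_pos_of_lt hρ1).ne'
  refine equivalentNorms_of_le
    (C := κ' * (ENNReal.ofReal (1 + B * (2 + 2 * 4 ^ r)) *
      ((1 - ENNReal.ofReal ρ)⁻¹ * ENNReal.ofReal (2 ^ α))))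
    (D := (ENNReal.ofReal (1 + 1 / b) + ENNReal.ofReal (1 + 2 ^ r / b)) * κ⁻¹) ?_ ?_
    (fun f => ?_) fun f => ?_
  · exact ENNReal.mul_ne_top hκt' (ENNReal.mul_ne_top ENNReal.ofReal_ne_top
      (ENNReal.mul_ne_top hρt ENNReal.ofReal_ne_top))
  · exact ENNReal.mul_ne_top (by simp) (ENNReal.inv_ne_top.2 hκ0)
  · refine (hκ' _ (h.isKProfile f)).trans ?_
    rw [mul_assoc, mul_assoc, mul_assoc]
    refine mul_le_mul' le_rfl ?_
    refine (seqNorm_mono (h.gridSeq_le_conv hS h0 hrn α f)).trans ?_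
    rw [seqNorm_const_mul hq]
    exact mul_le_mul' le_rfl ((seqNorm_conv_le hq _ _).trans
      (mul_le_mul' le_rfl (seqNorm_approxSeq_le hα.le hq f)))
  · refine (h.approxNorm_le_seqNorm hS h0 hrn α hq f).trans ?_
    rw [mul_assoc]
    refine mul_le_mul' le_rfl ?_
    rw [← ENNReal.div_eq_inv_mul, ENNReal.le_div_iff_mul_le (Or.inl hκ0) (Or.inl hκt), mul_comm]
    exact hκ _ (h.isKProfile f)

end Equivalence

end PaleyWiener

end

/-- `L` is a non-negative self-adjoint operator on `H`, and `0 < α < r`. The norm of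
`(H, H^r)^K_{α/r,q}` is equivalent to the approximation functional built from `PW_ω(√L)`.

First part: `H^r` is the domain of `L^{r/2}` with the graph norm.

Second part: `H^r` is the Sobolev space of any operators `D₁, …, D_d` for which this space is the
domain of `L^{r/2}` with equivalent norms. -/
theorem theorem7p3 {H : Type*} [NormedAddCommGroup H] [InnerProductSpace ℂ H] [CompleteSpace H]
    (L : H →ₗ.[ℂ] H) (hL : IsSelfAdjoint L) (hL0 : PaleyWiener.IsNonneg L)
    (α : ℝ) (hα : 0 < α) (r : ℕ) (hr : α < r) (q : ℝ≥0∞) (hq : 1 ≤ q) :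
    PaleyWiener.EquivalentNorms
      (PaleyWiener.interpNorm (PaleyWiener.halfPow L r).domain
        (PaleyWiener.graphNorm (PaleyWiener.halfPow L r)) (α / r) q)
      (PaleyWiener.approxNorm (PaleyWiener.posSqrt L) α q) ∧
    ∀ (d : ℕ) (D : Fin d → (H →ₗ.[ℂ] H)),
      PaleyWiener.sobolevDomain D r = (PaleyWiener.halfPow L r).domain →
      (∃ a A : ℝ, 0 < a ∧ 0 < A ∧
        ∀ (f : H) (h₁ : f ∈ PaleyWiener.sobolevDomain D r)
          (h₂ : f ∈ (PaleyWiener.halfPow L r).domain),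
          a * PaleyWiener.graphNorm (PaleyWiener.halfPow L r) ⟨f, h₂⟩
            ≤ PaleyWiener.sobolevNorm D r ⟨f, h₁⟩ ∧
          PaleyWiener.sobolevNorm D r ⟨f, h₁⟩
            ≤ A * PaleyWiener.graphNorm (PaleyWiener.halfPow L r) ⟨f, h₂⟩) →
      PaleyWiener.EquivalentNorms
        (PaleyWiener.interpNorm (PaleyWiener.sobolevDomain D r)
          (PaleyWiener.sobolevNorm D r) (α / r) q)
        (PaleyWiener.approxNorm (PaleyWiener.posSqrt L) α q) := by
  have hS := PaleyWiener.isPosSqrt_posSqrt hL hL0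
  refine ⟨?_, fun d D hdom ⟨a, A, ha, hA, hN⟩ => ?_⟩
  · have h : PaleyWiener.IsEquivGraphNorm (PaleyWiener.ppow (PaleyWiener.posSqrt L) r)
        (PaleyWiener.halfPow L r).domain (PaleyWiener.graphNorm (PaleyWiener.halfPow L r)) 1 1 :=
      ⟨rfl, one_pos, one_pos, fun _ _ _ => (one_mul _).le, fun _ _ _ => (one_mul _).ge⟩
    exact h.equivalentNorms hS.selfAdjoint hS.nonneg hα hr hq
  · have h : PaleyWiener.IsEquivGraphNorm (PaleyWiener.ppow (PaleyWiener.posSqrt L) r)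
        (PaleyWiener.sobolevDomain D r) (PaleyWiener.sobolevNorm D r) a A :=
      ⟨hdom, ha, hA, fun f h₁ h₂ => (hN f h₁ h₂).1, fun f h₁ h₂ => (hN f h₁ h₂).2⟩
    exact h.equivalentNorms hS.selfAdjoint hS.nonneg hα hr hq
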